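/- Let $\mathbb F_q$ be a finite field. Consider symmetric private information retrieval (SPIR) with two replicated, non-colluding databases, $K=3$ messages $W_1,W_2,W_3$ and message length $L=1$, i.e. the $W_k$ are independent and uniform on $\mathbb F_q$. The databases share common randomness $\mathcal R$, the user has private strategy randomness $\mathcal F$ (both discrete), and $W_{1:3},\mathcal F,\mathcal R$ are mutually independent. For a desired index $k$ the query $Q_n^{[k]}$ to database $n\in\{1,2\}$ is a function of $\mathcal F$, and the answer $A_n^{[k]}$ is a function of $(Q_n^{[k]},W_{1:3},\mathcal R)$; queries and answers have finite alphabets. Such a scheme is *achievable* if for all $k,k'$ and $n$ - (reliability) $H(W_k\mid \mathcal F,A_{1}^{[k]},A_2^{[k]})=0$; - (user privacy) $(Q_n^{[k]},A_n^{[k]},W_{1:3},\mathcal R)\sim(Q_n^{[k']},A_n^{[k']},W_{1:3},\mathcal R)$; - (database privacy) $I(W_{\bar k};\mathcal F,A_1^{[k]},A_2^{[k]})=0$, where $W_{\bar k}=(W_j)_{j\ne k}$. Its upload cost is $U=\log_2|\mathcal Q_1|+\log_2|\mathcal Q_2|$ and its download cost is $D=\log_q|\mathcal A_1|+\log_q|\mathcal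 A_2|$, where $\mathcal Q_n$ and $\mathcal A_n$ are the query and answer alphabets of database $n$. Entropies are in base $q$; for $q=2$ all quantities are in bits. Then: 1. The minimum of the total communication cost $U+D$ over all achievable schemes is $6$. 2. Some achievable scheme has $U=4$, $D=2$ (so $U+D=4+2=6$) and common randomness $H(\mathcal R)=1$, and every achievable scheme has $H(\mathcal R)\ge 1$; so the minimal amount of common randomness is $1$. 3. For real $U,D$, there is an achievable scheme with upload cost at most $U$ and download cost at most $D$ if and only if $$(U\ge 2\log_2 3\ \text{ and }\ D\ge 3)\quad\text{or}\quad(U\ge 4\ \text{ and }\ D\ge 2).$$ 4. The converse also holds for entropies: for every achievable scheme and every $k$, the upload cost $U$ and $D'=H(A_1^{[k]}\mid\mathcal F)+H(A_2^{[k]}\mid\mathcal F)$ satisfy ($U\ge 2\log_2 3$ and $D'\ge 3$) or ($U\ge 4$ and $D'\ge 2$). -/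

import Mathlib

open MeasureTheory ProbabilityTheory

noncomputable section

/-! Shannon quantities for random variables with countable alphabets on a probability space
`(Ω, μ)`. All of them take values in `[0, ∞]`. -/

/-- Shannon entropy `H(X) = ∑ₓ p(x) log_b (1 / p(x))` in base `b`. -/
def shannonEntropy {Ω α : Type*} [MeasurableSpace Ω] (μ : Measure Ω) (b : ℕ) (X : Ω → α) :
    ENNReal :=
  ∑' x, ENNReal.ofReal (Real.negMulLog (μ.real (X ⁻¹' {x})) / Real.log b)

/-- Conditional Shannon entropy `H(X | Y) = ∑_y P(Y = y) H(X | Y = y)` in base `b`. -/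
def condShannonEntropy {Ω α β : Type*} [MeasurableSpace Ω] (μ : Measure Ω) (b : ℕ)
    (X : Ω → α) (Y : Ω → β) : ENNReal :=
  ∑' y, μ (Y ⁻¹' {y}) * shannonEntropy (cond μ (Y ⁻¹' {y})) b X

/-- Mutual information `I(X ; Y)` (in nats): the Kullback-Leibler divergence of the joint law
from the product of the marginal laws. -/
def mutualInfo {Ω α β : Type*} [MeasurableSpace Ω] [MeasurableSpace α] [MeasurableSpace β]
    (μ : Measure Ω) (X : Ω → α) (Y : Ω → β) : ENNReal :=
  InformationTheory.klDiv (μ.map (fun ω => (X ω, Y ω))) ((μ.map X).prod (μ.map Y))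

/-- An `N`-database retrieval scheme for `K` messages of `L` symbols each from the finite
field `𝔽`, the databases sharing common randomness `R` and the user holding private strategy
randomness `F`. `Q n k` and `A n k` are the query to and the answer of database `n` when message
`k` is desired. All random variables live on one probability space `(Ω, μ)`; the alphabets of
the queries and the answers are finite, those of `F` and `R` are countable and discrete. -/
structure RetrievalScheme (𝔽 : Type) [Fintype 𝔽] [MeasurableSpace 𝔽] (N K L : ℕ) where
  Ω : Type
  [measΩ : MeasurableSpace Ω]
  μ : Measure Ω
  [prob : IsProbabilityMeasure μ]
  /-- alphabet of the user's strategy randomness -/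
  FAlph : Type
  [FCountable : Countable FAlph]
  [FMeas : MeasurableSpace FAlph]
  [FDiscrete : DiscreteMeasurableSpace FAlph]
  /-- alphabet of the databases' common randomness -/
  RAlph : Type
  [RCountable : Countable RAlph]
  [RMeas : MeasurableSpace RAlph]
  [RDiscrete : DiscreteMeasurableSpace RAlph]
  /-- set of possible queries to each database -/
  Query : Fin N → Type
  [QFintype : ∀ n, Fintype (Query n)]
  [QMeas : ∀ n, MeasurableSpace (Query n)]
  [QDiscrete : ∀ n, DiscreteMeasurableSpace (Query n)]
  /-- set of possible answers of each database -/
  Answer : Fin N → Type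
  [AFintype : ∀ n, Fintype (Answer n)]
  [AMeas : ∀ n, MeasurableSpace (Answer n)]
  [ADiscrete : ∀ n, DiscreteMeasurableSpace (Answer n)]
  W : Ω → Fin K → Fin L → 𝔽
  F : Ω → FAlph
  R : Ω → RAlph
  Q : (n : Fin N) → Fin K → Ω → Query n
  A : (n : Fin N) → Fin K → Ω → Answer n
  measurable_W : Measurable W
  measurable_F : Measurable F
  measurable_R : Measurable R
  measurable_Q : ∀ n k, Measurable (Q n k)
  measurable_A : ∀ n k, Measurable (A n k)
  /-- the `K L` message symbols are independent and uniform on `𝔽` -/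
  message_uniform : μ.map W = uniformOn Set.univ
  /-- `I(W_{1:K} ; F, R) = 0` -/
  message_indep : mutualInfo μ W (fun ω => (F ω, R ω)) = 0
  /-- the user's private randomness is independent of the databases' common randomness -/
  randomness_indep : mutualInfo μ F R = 0
  /-- `H(Q_1^{[k]}, …, Q_N^{[k]} | F) = 0` -/
  deterministic_query : ∀ k,
    condShannonEntropy μ (Fintype.card 𝔽) (fun ω n => Q n k ω) F = 0
  /-- `H(A_n^{[k]} | Q_n^{[k]}, W_{1:K}, R) = 0` -/
  deterministic_answer : ∀ n k,
    condShannonEntropy μ (Fintype.card 𝔽) (A n k) (fun ω => (Q n k ω, W ω, R ω)) = 0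

attribute [instance] RetrievalScheme.measΩ RetrievalScheme.prob RetrievalScheme.FCountable
  RetrievalScheme.FMeas RetrievalScheme.FDiscrete RetrievalScheme.RCountable
  RetrievalScheme.RMeas RetrievalScheme.RDiscrete RetrievalScheme.QFintype
  RetrievalScheme.QMeas RetrievalScheme.QDiscrete RetrievalScheme.AFintype
  RetrievalScheme.AMeas RetrievalScheme.ADiscrete

namespace RetrievalScheme

variable {𝔽 : Type} [Fintype 𝔽] [MeasurableSpace 𝔽] {N K L : ℕ}

/-- Reliability: `H(W_k | F, A_{1:N}^{[k]}) = 0` for all `k`. -/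
def Reliable (s : RetrievalScheme 𝔽 N K L) : Prop :=
  ∀ k, condShannonEntropy s.μ (Fintype.card 𝔽) (fun ω => s.W ω k)
    (fun ω => (s.F ω, fun n => s.A n k ω)) = 0

/-- User privacy: `(Q_n^{[k]}, A_n^{[k]}, W_{1:K}, R) ∼ (Q_n^{[k']}, A_n^{[k']}, W_{1:K}, R)`
for each database `n` and all `k, k'`. -/
def UserPrivate (s : RetrievalScheme 𝔽 N K L) : Prop :=
  ∀ n k k', IdentDistrib (fun ω => (s.Q n k ω, s.A n k ω, s.W ω, s.R ω))
    (fun ω => (s.Q n k' ω, s.A n k' ω, s.W ω, s.R ω)) s.μ s.μ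

/-- Database privacy: `I(W_{k̄} ; F, A_{1:N}^{[k]}) = 0` for all `k`, where `W_{k̄}` consists of
all messages other than `W_k`. -/
def DatabasePrivate (s : RetrievalScheme 𝔽 N K L) : Prop :=
  ∀ k, mutualInfo s.μ (fun ω (j : {j : Fin K // j ≠ k}) => s.W ω j)
    (fun ω => (s.F ω, fun n => s.A n k ω)) = 0

/-- An achievable SPIR scheme. -/
structure IsSPIR (s : RetrievalScheme 𝔽 N K L) : Prop where
  reliable : s.Reliable
  userPrivate : s.UserPrivate
  databasePrivate : s.DatabasePrivate

/-- Upload cost `U`: the number of bits needed to send one query to each database. -/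
def uploadCost (s : RetrievalScheme 𝔽 N K L) : ℝ :=
  ∑ n, Real.logb 2 (Fintype.card (s.Query n))

/-- Download cost `D`: the number of `q`-ary symbols, `q = |𝔽|` (bits if `q = 2`), needed to
send one answer from each database. -/
def downloadCost (s : RetrievalScheme 𝔽 N K L) : ℝ :=
  ∑ n, Real.logb (Fintype.card 𝔽) (Fintype.card (s.Answer n))

/-- `∑ₙ H(A_n^{[k]} | F)` in `q`-ary units: a lower bound for the expected size of the answers
under any prefix-free encoding of them, fixed-length or not. -/
def answerEntropy (s : RetrievalScheme 𝔽 N K L) (k : Fin K) : ENNReal :=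
  ∑ n, condShannonEntropy s.μ (Fintype.card 𝔽) (s.A n k) s.F

/-- The amount `H(R)` of common randomness, in `q`-ary units. -/
def commonRandomness (s : RetrievalScheme 𝔽 N K L) : ENNReal :=
  shannonEntropy s.μ (Fintype.card 𝔽) s.R

end RetrievalScheme

/-- The cost pair `(U, D)` is achievable: some achievable SPIR scheme has upload cost at most `U`
and download cost at most `D`. -/
def CostAchievable (𝔽 : Type) [Fintype 𝔽] [MeasurableSpace 𝔽] (N K L : ℕ) (U D : ℝ) : Prop :=
  ∃ s : RetrievalScheme 𝔽 N K L, s.IsSPIR ∧ s.uploadCost ≤ U ∧ s.downloadCost ≤ D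

end

/-! Fixing an atom of the user's randomness turns the scheme into a labelled bipartite graph. Its
vertices are the queries to the two databases. A pair `(a, b)` carries label `k` if it is asked with
positive probability when message `k` is desired. Since `F` is independent of `(W, R)`, the two
answers on such an edge, viewed as functions of `(W, R)`, still determine `W k` and are independent
of the other messages (`discloses_of_atom`). With at least two field elements no edge has two labels
(`index_unique`). User privacy fixes the query marginals, so the three joint query laws are
couplings of the same marginals with disjoint supports (`DisjointCouplings`). Hence every vertex of
positive probability meets all three labels, and each side has at least three such vertices.

Each endpoint of an edge labelled `k` also lies on an edge with another label, so each answer alone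
is independent of `W k`. Together the two determine it, so no value of either has probability above
`1/q`. This gives answer entropy at least `2`, and a similar count gives `H(R) ≥ 1`
(`measureReal_randomness_le`). If both sides have at least four vertices, then `U ≥ 4`. If one side
has exactly three, a mass count completes every edge to a square with labels `c, l / l, m`
(`exists_square`). The submodular inequality `finEntropy_add_le_of_disclosure` on that square then
forces entropy at least `3`.

Both corners are attained. For `(4, 2)` the queries are the even and odd vertices of the cube
`{0,1}³`, and adjacent vertices give masked sums differing by one message up to sign. For `(2 log₂
3, 3)` the labels form the Latin square `i + j` mod `3`. -/

noncomputable section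

/-! ### Inequalities for sums of `negMulLog`. -/

namespace Real

lemma negMulLog_sum_le {ι : Type*} (s : Finset ι) (p : ι → ℝ) (hp : ∀ i ∈ s, 0 ≤ p i) :
    negMulLog (∑ i ∈ s, p i) ≤ ∑ i ∈ s, negMulLog (p i) := by
  rw [negMulLog, ← Finset.sum_neg_distrib, Finset.sum_mul]
  refine Finset.sum_le_sum fun i hi => ?_
  rcases (hp i hi).eq_or_lt with h | h
  · simp [← h]
  · rw [negMulLog]
    have := log_le_log h (Finset.single_le_sum hp hi)
    nlinarith

/-- Submodularity of entropy for a finite nonnegative weight. -/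
lemma sum_negMulLog_submodular {α β γ : Type*} [Fintype α] [Fintype β] [Fintype γ]
    (p : α → β → γ → ℝ) (hp : ∀ a b c, 0 ≤ p a b c) :
    (∑ a, ∑ b, ∑ c, negMulLog (p a b c)) + ∑ c, negMulLog (∑ a, ∑ b, p a b c) ≤
      (∑ a, ∑ c, negMulLog (∑ b, p a b c)) + ∑ b, ∑ c, negMulLog (∑ a, p a b c) := by
  set pA : α → γ → ℝ := fun a c => ∑ b, p a b c with hA
  set pB : β → γ → ℝ := fun b c => ∑ a, p a b c with hB
  set pC : γ → ℝ := fun c => ∑ a, ∑ b, p a b c with hC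
  have hA0 : ∀ a c, 0 ≤ pA a c := fun a c => Finset.sum_nonneg fun b _ => hp a b c
  have hB0 : ∀ b c, 0 ≤ pB b c := fun b c => Finset.sum_nonneg fun a _ => hp a b c
  have hCA : ∀ c, ∑ a, pA a c = pC c := fun c => rfl
  have hCB : ∀ c, ∑ b, pB b c = pC c := fun c => Finset.sum_comm
  have hC0 : ∀ c, 0 ≤ pC c := fun c => Finset.sum_nonneg fun a _ => hA0 a c
  have hpA : ∀ a b c, p a b c ≤ pA a c := fun a b c =>
    Finset.single_le_sum (fun b _ => hp a b c) (Finset.mem_univ b)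
  have hpB : ∀ a b c, p a b c ≤ pB b c := fun a b c =>
    Finset.single_le_sum (fun a _ => hp a b c) (Finset.mem_univ a)
  have hAC : ∀ a c, pA a c ≤ pC c := fun a c =>
    Finset.single_le_sum (fun a _ => hA0 a c) (Finset.mem_univ a)
  -- This is `log t ≤ t - 1` at `t = p(a,c) p(b,c) / (p(c) p(a,b,c))`, multiplied by `p(a,b,c)`. The
  -- right-hand sides sum to zero.
  have key : ∀ a b c, negMulLog (p a b c) + -p a b c * log (pC c) + p a b c * log (pA a c)
      + p a b c * log (pB b c) ≤ pA a c * pB b c / pC c - p a b c := by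
    intro a b c
    rcases (hp a b c).eq_or_lt with h | h
    · simp only [← h, negMulLog_zero]
      have := div_nonneg (mul_nonneg (hA0 a c) (hB0 b c)) (hC0 c)
      linarith
    · have h1 := h.trans_le (hpA a b c)
      have h2 := h.trans_le (hpB a b c)
      have h3 := h1.trans_le (hAC a c)
      have := log_le_sub_one_of_pos (x := pA a c * pB b c / (pC c * p a b c)) (by positivity)
      rw [log_div (by positivity) (by positivity), log_mul h1.ne' h2.ne',
        log_mul h3.ne' h.ne'] at this
      have h4 := mul_le_mul_of_nonneg_left this h.le
      have h5 : p a b c * (pA a c * pB b c / (pC c * p a b c) - 1)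
          = pA a c * pB b c / pC c - p a b c := by field_simp
      rw [h5] at h4
      rw [negMulLog]
      linarith
  have hsum : ∑ a, ∑ b, ∑ c, (pA a c * pB b c / pC c - p a b c) = 0 := by
    simp only [Finset.sum_sub_distrib]
    rw [sub_eq_zero]
    have e1 : ∑ a, ∑ b, ∑ c, pA a c * pB b c / pC c = ∑ c, pC c := by
      calc ∑ a, ∑ b, ∑ c, pA a c * pB b c / pC c
          = ∑ c, ∑ a, ∑ b, pA a c * pB b c / pC c :=
            (Finset.sum_congr rfl fun a _ => Finset.sum_comm).trans Finset.sum_comm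
        _ = ∑ c, pC c := by
            refine Finset.sum_congr rfl fun c _ => ?_
            simp_rw [← Finset.sum_div, ← Finset.mul_sum, ← Finset.sum_mul, hCA, hCB]
            -- No case split on `pC c = 0` is needed: there both sides are `0`, as division by zero
            -- gives zero.
            exact mul_self_div_self _
    rw [e1]
    simp only [hC]
    rw [Finset.sum_comm]
    refine Finset.sum_congr rfl fun a _ => Finset.sum_comm
  have tot := Finset.sum_le_sum fun a (_ : a ∈ Finset.univ) =>
    Finset.sum_le_sum fun b (_ : b ∈ Finset.univ) =>
    Finset.sum_le_sum fun c (_ : c ∈ Finset.univ) => key a b c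
  rw [hsum] at tot
  simp only [Finset.sum_add_distrib] at tot
  have eA : ∑ a, ∑ b, ∑ c, p a b c * log (pA a c) = - ∑ a, ∑ c, negMulLog (pA a c) := by
    simp only [negMulLog, ← Finset.sum_neg_distrib]
    refine Finset.sum_congr rfl fun a _ => ?_
    rw [Finset.sum_comm]
    refine Finset.sum_congr rfl fun c _ => ?_
    rw [← Finset.sum_mul]; ring
  have eB : ∑ a, ∑ b, ∑ c, p a b c * log (pB b c) = - ∑ b, ∑ c, negMulLog (pB b c) := by
    simp only [negMulLog, ← Finset.sum_neg_distrib]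
    rw [Finset.sum_comm]
    refine Finset.sum_congr rfl fun b _ => ?_
    rw [Finset.sum_comm]
    refine Finset.sum_congr rfl fun c _ => ?_
    rw [← Finset.sum_mul]; ring
  have eC : ∑ a, ∑ b, ∑ c, -p a b c * log (pC c) = ∑ c, negMulLog (pC c) := by
    simp only [negMulLog]
    have : ∀ a, ∑ b, ∑ c, -p a b c * log (pC c) = ∑ c, -pA a c * log (pC c) := fun a => by
      rw [Finset.sum_comm]
      refine Finset.sum_congr rfl fun c _ => ?_
      rw [← Finset.sum_mul, Finset.sum_neg_distrib]
    simp_rw [this]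
    rw [Finset.sum_comm]
    refine Finset.sum_congr rfl fun c _ => ?_
    rw [← Finset.sum_mul, Finset.sum_neg_distrib]
  rw [eA, eB, eC] at tot
  linarith

end Real

/-! ### Entropy of finite-valued random variables. -/

section FiniteEntropy

variable {Ω : Type*} [MeasurableSpace Ω] {α β γ : Type*}

/-- Shannon entropy in nats of a random variable with a finite alphabet. -/
def finEntropy (μ : Measure Ω) [Fintype α] (X : Ω → α) : ℝ :=
  ∑ x, Real.negMulLog (μ.real (X ⁻¹' {x}))

lemma finEntropy_congr {μ : Measure Ω} [Fintype α] {X X' : Ω → α} (h : X =ᵐ[μ] X') :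
    finEntropy μ X = finEntropy μ X' := by
  refine Finset.sum_congr rfl fun x _ => ?_
  congr 1
  refine measureReal_congr ?_
  filter_upwards [h] with ω hω
  exact congrArg (· = x) hω |>.to_iff |> propext

lemma finEntropy_nonneg {μ : Measure Ω} [IsProbabilityMeasure μ] [Fintype α] {X : Ω → α} :
    0 ≤ finEntropy μ X :=
  Finset.sum_nonneg fun _ _ => Real.negMulLog_nonneg measureReal_nonneg measureReal_le_one

lemma finEntropy_of_uniform {μ : Measure Ω} [Fintype α] {X : Ω → α}
    (h : ∀ x, μ.real (X ⁻¹' {x}) = (Fintype.card α : ℝ)⁻¹) :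
    finEntropy μ X = Real.log (Fintype.card α) := by
  rcases eq_or_ne (Fintype.card α : ℝ) 0 with h0 | h0
  · have : IsEmpty α := Fintype.card_eq_zero_iff.1 (by exact_mod_cast h0)
    simp [finEntropy]
  · simp [finEntropy, h, Real.negMulLog, h0]

lemma ProbabilityTheory.IndepFun.measureReal_preimage_prodMk {μ : Measure Ω}
    [MeasurableSpace α] [MeasurableSingletonClass α] [MeasurableSpace β]
    [MeasurableSingletonClass β] {X : Ω → α} {Y : Ω → β} (h : IndepFun X Y μ) (x : α) (y : β) :
    μ.real ((fun ω => (X ω, Y ω)) ⁻¹' {(x, y)}) = μ.real (X ⁻¹' {x}) * μ.real (Y ⁻¹' {y}) := by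
  rw [← Set.singleton_prod_singleton, Set.mk_preimage_prod, measureReal_def,
    h.measure_inter_preimage_eq_mul _ _ (measurableSet_singleton x) (measurableSet_singleton y),
    ENNReal.toReal_mul]
  rfl

variable {μ : Measure Ω} [IsProbabilityMeasure μ]
  [Fintype α] [MeasurableSpace α] [MeasurableSingletonClass α]
  [Fintype β] [MeasurableSpace β] [MeasurableSingletonClass β]
  [Fintype γ] {X : Ω → α} {Y : Ω → β}

lemma sum_measureReal_preimage_inter (hX : Measurable X) (s : Set Ω) :
    ∑ x, μ.real (X ⁻¹' {x} ∩ s) = μ.real s := by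
  have := sum_measureReal_preimage_singleton (μ := μ.restrict s) (f := X) Finset.univ
    (fun y _ => hX (measurableSet_singleton y))
  simp only [Finset.coe_univ, Set.preimage_univ] at this
  simpa [measureReal_restrict_apply, hX (measurableSet_singleton _)] using this

lemma sum_measureReal_preimage (hX : Measurable X) : ∑ x, μ.real (X ⁻¹' {x}) = 1 := by
  simpa using sum_measureReal_preimage_inter (μ := μ) hX Set.univ

/-- A function of a random variable has no more entropy than the variable. -/
lemma finEntropy_le_of_ae_eq_comp {Z : Ω → γ} (hY : Measurable Y) (f : β → γ)
    (h : Z =ᵐ[μ] fun ω => f (Y ω)) : finEntropy μ Z ≤ finEntropy μ Y := by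
  classical
  rw [finEntropy_congr h, finEntropy, finEntropy,
    ← Finset.sum_fiberwise (s := Finset.univ) (g := f)]
  refine Finset.sum_le_sum fun x _ => ?_
  have : μ.real ((fun ω => f (Y ω)) ⁻¹' {x}) =
      ∑ y ∈ Finset.univ.filter (fun y => f y = x), μ.real (Y ⁻¹' {y}) := by
    rw [sum_measureReal_preimage_singleton _ (fun y _ => hY (measurableSet_singleton y))]
    congr 1
    ext ω; simp
  rw [this]
  exact Real.negMulLog_sum_le _ _ fun _ _ => measureReal_nonneg

lemma finEntropy_submodular (hX : Measurable X) (hY : Measurable Y) {Z : Ω → γ} :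
    finEntropy μ (fun ω => (X ω, Y ω, Z ω)) + finEntropy μ Z ≤
      finEntropy μ (fun ω => (X ω, Z ω)) + finEntropy μ (fun ω => (Y ω, Z ω)) := by
  have := Real.sum_negMulLog_submodular
    (fun a b c => μ.real (X ⁻¹' {a} ∩ (Y ⁻¹' {b} ∩ Z ⁻¹' {c}))) (fun _ _ _ => measureReal_nonneg)
  have e1 : ∀ b c, ∑ a, μ.real (X ⁻¹' {a} ∩ (Y ⁻¹' {b} ∩ Z ⁻¹' {c})) =
      μ.real (Y ⁻¹' {b} ∩ Z ⁻¹' {c}) := fun b c =>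
    sum_measureReal_preimage_inter hX _
  have e2 : ∀ a c, ∑ b, μ.real (X ⁻¹' {a} ∩ (Y ⁻¹' {b} ∩ Z ⁻¹' {c})) =
      μ.real (X ⁻¹' {a} ∩ Z ⁻¹' {c}) := fun a c => by
    simp_rw [Set.inter_left_comm (X ⁻¹' {a})]
    exact sum_measureReal_preimage_inter hY _
  simp_rw [e2, e1, fun c => sum_measureReal_preimage_inter (μ := μ) hX _] at this
  simp only [finEntropy, Fintype.sum_prod_type]
  simpa only [← Set.singleton_prod_singleton, Set.mk_preimage_prod] using this

/-- Submodularity with a constant as the third variable. -/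
lemma finEntropy_prodMk_le (hX : Measurable X) (hY : Measurable Y) :
    finEntropy μ (fun ω => (X ω, Y ω)) ≤ finEntropy μ X + finEntropy μ Y := by
  have h := finEntropy_submodular (μ := μ) hX hY (Z := fun _ => ())
  have h0 := finEntropy_nonneg (μ := μ) (X := fun _ : Ω => ())
  have h1 := finEntropy_le_of_ae_eq_comp (μ := μ) (Z := fun ω => (X ω, Y ω))
    (Y := fun ω => (X ω, Y ω, ())) (by fun_prop) (fun p => (p.1, p.2.1)) (by rfl)
  have h2 := finEntropy_le_of_ae_eq_comp (μ := μ) (Z := fun ω => (X ω, ())) hX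
    (fun p => (p, ())) (by rfl)
  have h3 := finEntropy_le_of_ae_eq_comp (μ := μ) (Z := fun ω => (Y ω, ())) hY
    (fun p => (p, ())) (by rfl)
  linarith

lemma ProbabilityTheory.IndepFun.finEntropy_prodMk (hX : Measurable X) (hY : Measurable Y)
    (h : IndepFun X Y μ) :
    finEntropy μ (fun ω => (X ω, Y ω)) = finEntropy μ X + finEntropy μ Y := by
  simp only [finEntropy, Fintype.sum_prod_type, h.measureReal_preimage_prodMk, Real.negMulLog_mul,
    Finset.sum_add_distrib, ← Finset.sum_mul, ← Finset.mul_sum, sum_measureReal_preimage hX,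
    sum_measureReal_preimage hY, one_mul]

/-- Jensen's inequality for the concave function `negMulLog` with equal weights on the alphabet. -/
lemma finEntropy_le_log_card [Nonempty α] (hX : Measurable X) :
    finEntropy μ X ≤ Real.log (Fintype.card α) := by
  have hc : (0 : ℝ) < Fintype.card α := by exact_mod_cast Fintype.card_pos
  have := Real.concaveOn_negMulLog.le_map_sum (t := Finset.univ)
    (w := fun _ : α => (Fintype.card α : ℝ)⁻¹) (p := fun x => μ.real (X ⁻¹' {x}))
    (fun _ _ => by positivity) (by simp [hc.ne']) (fun _ _ => measureReal_nonneg)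
  simp only [smul_eq_mul, ← Finset.mul_sum, sum_measureReal_preimage hX] at this
  rw [mul_one, Real.negMulLog, Real.log_inv, neg_mul_neg] at this
  exact le_of_mul_le_mul_left this (by positivity)

end FiniteEntropy

/-! ### Consequences of vanishing conditional entropy and mutual information. -/

section Shannon

variable {Ω α β : Type*} [MeasurableSpace Ω] {μ : Measure Ω} [IsProbabilityMeasure μ] {b : ℕ}

lemma Real.log_natCast_pos (hb : 2 ≤ b) : 0 < Real.log b :=
  Real.log_pos (by exact_mod_cast hb)

lemma shannonEntropy_eq_finEntropy [Fintype α] (X : Ω → α) :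
    shannonEntropy μ b X = ENNReal.ofReal (finEntropy μ X / Real.log b) := by
  rw [shannonEntropy, tsum_fintype, finEntropy, Finset.sum_div, ENNReal.ofReal_sum_of_nonneg]
  exact fun x _ => div_nonneg (Real.negMulLog_nonneg measureReal_nonneg measureReal_le_one)
    (Real.log_natCast_nonneg b)

lemma tsum_measure_preimage_eq_one [Countable α] [MeasurableSpace α] [MeasurableSingletonClass α]
    {X : Ω → α} (hX : Measurable X) : ∑' x, μ (X ⁻¹' {x}) = 1 := by
  have := tsum_measure_preimage_singleton (μ := μ) (Set.to_countable (Set.univ : Set α))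
    (fun x _ => hX (measurableSet_singleton x))
  rw [Set.preimage_univ, measure_univ] at this
  rw [← this, tsum_univ (fun x => μ (X ⁻¹' {x}))]

/-- A variable each of whose values has probability at most `1 / b` has entropy at least `1`. -/
lemma one_le_shannonEntropy [Countable α] [MeasurableSpace α] [MeasurableSingletonClass α]
    {X : Ω → α} (hX : Measurable X) (hb : 2 ≤ b) (h : ∀ x, μ.real (X ⁻¹' {x}) ≤ (b : ℝ)⁻¹) :
    1 ≤ shannonEntropy μ b X := by
  -- With `1` written as the total mass, the bound holds term by term: `p ≤ 1/b` gives `-p log p ≥ p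
  -- log b`.
  rw [← tsum_measure_preimage_eq_one (μ := μ) hX]
  refine ENNReal.tsum_le_tsum fun x => ?_
  rw [← ofReal_measureReal]
  refine ENNReal.ofReal_le_ofReal ?_
  rw [le_div_iff₀ (Real.log_natCast_pos hb), Real.negMulLog]
  rcases (measureReal_nonneg (μ := μ) (s := X ⁻¹' {x})).eq_or_lt with h0 | h0
  · simp [← h0]
  · have := Real.log_le_log h0 (h x)
    rw [Real.log_inv] at this
    nlinarith

/-- On an atom of `Y` every term `-p log p` vanishes, so each value of `X` has conditional mass `0`
or `1`, and some mass is nonzero. The hypothesis `2 ≤ b` keeps `log b` positive, so that dividing by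
it loses nothing. -/
lemma ae_eq_comp_of_condShannonEntropy_eq_zero [Fintype α] [MeasurableSpace α]
    [MeasurableSingletonClass α] [Countable β] [MeasurableSpace β] [MeasurableSingletonClass β]
    {X : Ω → α} {Y : Ω → β} (hX : Measurable X) (hY : Measurable Y) (hb : 2 ≤ b)
    (h : condShannonEntropy μ b X Y = 0) : ∃ f : β → α, X =ᵐ[μ] fun ω => f (Y ω) := by
  have key : ∀ y, ∃ x, μ (Y ⁻¹' {y} ∩ {ω | X ω ≠ x}) = 0 := by
    intro y
    by_cases hy : μ (Y ⁻¹' {y}) = 0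
    · have : Nonempty Ω := nonempty_of_isProbabilityMeasure μ
      exact ⟨X (Classical.arbitrary Ω), measure_mono_null Set.inter_subset_left hy⟩
    have h0 := ENNReal.tsum_eq_zero.1 h y
    replace h0 := (mul_eq_zero.1 h0).resolve_left hy
    have := cond_isProbabilityMeasure hy
    have hs := sum_measureReal_preimage (μ := μ[|Y ⁻¹' {y}]) hX
    obtain ⟨x, hx⟩ : ∃ x, (μ[|Y ⁻¹' {y}]).real (X ⁻¹' {x}) ≠ 0 := by
      by_contra! hc
      simp [hc] at hs
    refine ⟨x, ?_⟩
    have h2 := ENNReal.ofReal_eq_zero.1 (ENNReal.tsum_eq_zero.1 h0 x)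
    have h3 := Real.negMulLog_nonneg
      (measureReal_nonneg (μ := μ[|Y ⁻¹' {y}]) (s := X ⁻¹' {x})) measureReal_le_one
    have h4 : Real.negMulLog ((μ[|Y ⁻¹' {y}]).real (X ⁻¹' {x})) = 0 := by
      refine le_antisymm ?_ h3
      by_contra! hc
      exact absurd (div_pos hc (Real.log_natCast_pos hb)) (not_lt.2 h2)
    have h5 : (μ[|Y ⁻¹' {y}]).real (X ⁻¹' {x}) = 1 := by
      rw [Real.negMulLog, mul_eq_zero, neg_eq_zero, or_iff_right hx, Real.log_eq_zero] at h4
      rcases h4 with h4 | h4 | h4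
      · exact absurd h4 hx
      · exact h4
      · linarith [measureReal_nonneg (μ := μ[|Y ⁻¹' {y}]) (s := X ⁻¹' {x})]
    have h6 := probReal_compl_eq_one_sub (μ := μ[|Y ⁻¹' {y}]) (hX (measurableSet_singleton x))
    rw [h5, sub_self, measureReal_eq_zero_iff, cond_apply (hY (measurableSet_singleton y))] at h6
    exact (mul_eq_zero.1 h6).resolve_left (ENNReal.inv_ne_zero.2 (measure_ne_top _ _))
  choose f hf using key
  refine ⟨f, ?_⟩
  refine measure_mono_null (fun ω hω => ?_) (measure_iUnion_null hf)
  exact Set.mem_iUnion.2 ⟨Y ω, rfl, hω⟩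

lemma condShannonEntropy_comp_eq_zero [MeasurableSpace β] [MeasurableSingletonClass β]
    {Y : Ω → β} (hY : Measurable Y) (f : β → α) :
    condShannonEntropy μ b (fun ω => f (Y ω)) Y = 0 := by
  refine ENNReal.tsum_eq_zero.2 fun y => ?_
  by_cases hy : μ (Y ⁻¹' {y}) = 0
  · simp [hy]
  refine mul_eq_zero.2 (Or.inr (ENNReal.tsum_eq_zero.2 fun x => ?_))
  have mY := hY (measurableSet_singleton y)
  have h : (μ[|Y ⁻¹' {y}]).real ((fun ω => f (Y ω)) ⁻¹' {x}) = 0 ∨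
      (μ[|Y ⁻¹' {y}]).real ((fun ω => f (Y ω)) ⁻¹' {x}) = 1 := by
    simp only [measureReal_def, cond_apply mY]
    by_cases hx : f y = x
    · right
      rw [Set.inter_eq_left.2, ENNReal.inv_mul_cancel hy (measure_ne_top _ _), ENNReal.toReal_one]
      rintro ω rfl
      exact hx
    · left
      rw [(Set.disjoint_iff_inter_eq_empty.1 _), measure_empty, mul_zero, ENNReal.toReal_zero]
      refine Set.disjoint_left.2 ?_
      rintro ω rfl h
      exact hx h
  rcases h with h | h <;> simp [h]

lemma mutualInfo_eq_zero_iff [MeasurableSpace α] [MeasurableSpace β] {X : Ω → α} {Y : Ω → β}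
    (hX : Measurable X) (hY : Measurable Y) : mutualInfo μ X Y = 0 ↔ IndepFun X Y μ := by
  have := Measure.isProbabilityMeasure_map (μ := μ) hX.aemeasurable
  have := Measure.isProbabilityMeasure_map (μ := μ) hY.aemeasurable
  have := Measure.isProbabilityMeasure_map (μ := μ) (hX.prodMk hY).aemeasurable
  rw [mutualInfo, InformationTheory.klDiv_eq_zero_iff,
    indepFun_iff_map_prod_eq_prod_map_map hX.aemeasurable hY.aemeasurable]

end Shannon

/-! ### The entropy inequality on a square of queries. -/

section TwoByTwo

variable {Ω : Type*} [MeasurableSpace Ω] {μ : Measure Ω} [IsProbabilityMeasure μ]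
  {κ α β : Type*} [Fintype κ] [MeasurableSpace κ] [MeasurableSingletonClass κ]
  [Fintype α] [MeasurableSpace α] [MeasurableSingletonClass α]
  [Fintype β] [MeasurableSpace β] [MeasurableSingletonClass β]

/-- If `(x, y)` discloses `V`, both `(x', y)` and `(x, y')` disclose `U`, and `(x', y')` is
independent of `(U, V)`, then `H(U, V) + H(U) ≤ H(x) + H(y)`. -/
lemma finEntropy_add_le_of_disclosure {x x' : Ω → α} {y y' : Ω → β} {U V : Ω → κ}
    (hx : Measurable x) (hx' : Measurable x') (hy : Measurable y) (hy' : Measurable y')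
    (hU : Measurable U) (hV : Measurable V)
    (hUx' : ∃ d : α × β → κ, U =ᵐ[μ] fun ω => d (x' ω, y ω))
    (hUx : ∃ d : α × β → κ, U =ᵐ[μ] fun ω => d (x ω, y' ω))
    (hVx : ∃ d : α × β → κ, V =ᵐ[μ] fun ω => d (x ω, y ω))
    (hUy' : IndepFun U y' μ) (hUV : IndepFun (fun ω => (U ω, V ω)) (fun ω => (x' ω, y' ω)) μ) :
    finEntropy μ (fun ω => (U ω, V ω)) + finEntropy μ U ≤ finEntropy μ x + finEntropy μ y := by
  obtain ⟨d₁, h₁⟩ := hUx'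
  obtain ⟨d₂, h₂⟩ := hUx
  obtain ⟨d₃, h₃⟩ := hVx
  -- Write `Z = (y, y', U)`. The facts `e1` to `e5` give `H(U, V) ≤ H(y) + H(V, Z) - H(Z)`: the term
  -- `H(x', y')` produced by independence cancels the one from `e5`.
  have e1 := hUV.finEntropy_prodMk (by fun_prop) (by fun_prop)
  have e2 : finEntropy μ (fun ω => ((U ω, V ω), (x' ω, y' ω))) ≤
      finEntropy μ (fun ω => (x' ω, V ω, y ω, y' ω, U ω)) :=
    finEntropy_le_of_ae_eq_comp (by fun_prop)
      (fun p => ((p.2.2.2.2, p.2.1), (p.1, p.2.2.2.1))) (by rfl)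
  have e3 := finEntropy_submodular (μ := μ) (X := x') (Y := V) (Z := fun ω => (y ω, y' ω, U ω))
    hx' hV
  have e4 : finEntropy μ (fun ω => (x' ω, y ω, y' ω, U ω)) ≤
      finEntropy μ (fun ω => (y ω, x' ω, y' ω)) := by
    refine finEntropy_le_of_ae_eq_comp (by fun_prop)
      (fun p => (p.2.1, p.1, p.2.2, d₁ (p.2.1, p.1))) ?_
    filter_upwards [h₁] with ω h
    rw [h]
  have e5 := finEntropy_prodMk_le (μ := μ) (X := y) (Y := fun ω => (x' ω, y' ω)) hy (by fun_prop)
  -- As `V` is a function of `(x, y)`, it is replaced by `x`. The remaining facts then bound `H(x,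
  -- Z) - H(Z)` by `H(x) - H(U)`, where `H(y')` cancels because `y'` is independent of `U`.
  have e6 : finEntropy μ (fun ω => (V ω, y ω, y' ω, U ω)) ≤
      finEntropy μ (fun ω => (x ω, y ω, y' ω, U ω)) := by
    refine finEntropy_le_of_ae_eq_comp (by fun_prop)
      (fun p => (d₃ (p.1, p.2.1), p.2.1, p.2.2.1, p.2.2.2)) ?_
    filter_upwards [h₃] with ω h
    rw [h]
  have e7 := finEntropy_submodular (μ := μ) (X := x) (Y := y) (Z := fun ω => (y' ω, U ω))
    hx hy
  have e8 : finEntropy μ (fun ω => (x ω, y' ω, U ω)) ≤ finEntropy μ (fun ω => (x ω, y' ω)) := by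
    refine finEntropy_le_of_ae_eq_comp (by fun_prop)
      (fun p => (p.1, p.2, d₂ (p.1, p.2))) ?_
    filter_upwards [h₂] with ω h
    rw [h]
  have e9 := finEntropy_prodMk_le (μ := μ) hx hy'
  have e10 : finEntropy μ (fun ω => (U ω, y' ω)) ≤ finEntropy μ (fun ω => (y' ω, U ω)) :=
    finEntropy_le_of_ae_eq_comp (by fun_prop) (fun p => (p.2, p.1)) (by rfl)
  have e11 := hUy'.finEntropy_prodMk hU hy'
  linarith

end TwoByTwo

/-! ### Pairs of answers that reveal exactly one message. -/

/-- The pair `(x, y)` discloses the component `k` of `W`: it determines `W k`, and it is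
independent of the family of the other components. -/
structure Discloses {Ω ι κ α β : Type*} [MeasurableSpace Ω] [MeasurableSpace κ]
    [MeasurableSpace α] [MeasurableSpace β] (μ : Measure Ω) (W : Ω → ι → κ) (k : ι)
    (x : Ω → α) (y : Ω → β) : Prop where
  determined : ∃ d : α × β → κ, (fun ω => W ω k) =ᵐ[μ] fun ω => d (x ω, y ω)
  indep : IndepFun (fun ω (j : {j // j ≠ k}) => W ω j) (fun ω => (x ω, y ω)) μ

/-- The components of `W` are independent and uniform. -/
structure IsUniformFamily {Ω ι κ : Type*} [MeasurableSpace Ω] [MeasurableSpace κ] [Fintype κ]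
    (μ : Measure Ω) (W : Ω → ι → κ) : Prop where
  measurable : ∀ j, Measurable fun ω => W ω j
  indep : iIndepFun (fun j ω => W ω j) μ
  uniform : ∀ j w, μ.real ((fun ω => W ω j) ⁻¹' {w}) = (Fintype.card κ : ℝ)⁻¹

section

variable {Ω ι κ α β : Type*} [MeasurableSpace Ω]
  [MeasurableSpace κ] [Fintype κ] [MeasurableSingletonClass κ]
  {μ : Measure Ω} [IsProbabilityMeasure μ] {W : Ω → ι → κ}

namespace IsUniformFamily

omit [MeasurableSingletonClass κ] [IsProbabilityMeasure μ] in
lemma finEntropy_eq (hW : IsUniformFamily μ W) (j : ι) :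
    finEntropy μ (fun ω => W ω j) = Real.log (Fintype.card κ) :=
  finEntropy_of_uniform (hW.uniform j)

lemma finEntropy_pair (hW : IsUniformFamily μ W) {j l : ι} (h : j ≠ l) :
    finEntropy μ (fun ω => (W ω j, W ω l)) = 2 * Real.log (Fintype.card κ) := by
  rw [(hW.indep.indepFun h).finEntropy_prodMk (hW.measurable j) (hW.measurable l),
    hW.finEntropy_eq, hW.finEntropy_eq, two_mul]

omit [IsProbabilityMeasure μ] in
lemma measureReal_preimage_comp {ι' : Type*} [Fintype ι'] (hW : IsUniformFamily μ W) {g : ι' → ι}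
    (hg : g.Injective) (w : ι' → κ) :
    μ.real ((fun ω i => W ω (g i)) ⁻¹' {w}) = (Fintype.card κ : ℝ)⁻¹ ^ Fintype.card ι' := by
  have h := (hW.indep.precomp hg).measure_inter_preimage_eq_mul Finset.univ
    (sets := fun i => {w i}) (fun i _ => measurableSet_singleton _)
  have e : (fun ω i => W ω (g i)) ⁻¹' {w} =
      ⋂ i ∈ (Finset.univ : Finset ι'), (fun ω => W ω (g i)) ⁻¹' {w i} := by
    ext ω
    simp [funext_iff]
  rw [e, measureReal_def, h, ENNReal.toReal_prod]
  simp only [← measureReal_def, hW.uniform, Finset.prod_const, Finset.card_univ]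

end IsUniformFamily

variable [MeasurableSpace α] [MeasurableSpace β] {k k' : ι} {x : Ω → α} {y : Ω → β}

namespace Discloses

omit [Fintype κ] [MeasurableSingletonClass κ] [IsProbabilityMeasure μ] in
lemma swap (h : Discloses μ W k x y) : Discloses μ W k y x where
  determined := by
    obtain ⟨d, hd⟩ := h.determined
    exact ⟨fun p => d p.swap, hd⟩
  indep := h.indep.comp measurable_id measurable_swap

omit [Fintype κ] [MeasurableSingletonClass κ] [IsProbabilityMeasure μ] in
lemma indepFun_pair (h : Discloses μ W k x y) {j l : ι} (hj : j ≠ k) (hl : l ≠ k) :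
    IndepFun (fun ω => (W ω j, W ω l)) (fun ω => (x ω, y ω)) μ :=
  h.indep.comp (φ := fun w : {j // j ≠ k} → κ => (w ⟨j, hj⟩, w ⟨l, hl⟩)) (by fun_prop)
    measurable_id

omit [Fintype κ] [MeasurableSingletonClass κ] [IsProbabilityMeasure μ] in
lemma indepFun (h : Discloses μ W k x y) {j : ι} (hj : j ≠ k) :
    IndepFun (fun ω => W ω j) (fun ω => (x ω, y ω)) μ :=
  (h.indepFun_pair hj hj).comp measurable_fst measurable_id

variable [MeasurableSingletonClass α] [MeasurableSingletonClass β] [Fintype α] [Fintype β]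

/-- If `k ≠ k'`, then `W k` is a function of `(x, y)` and also independent of it, hence independent
of itself. This contradicts its positive entropy `log |κ|`. -/
lemma index_unique (hW : IsUniformFamily μ W) (hκ : 2 ≤ Fintype.card κ)
    (h : Discloses μ W k x y) (h' : Discloses μ W k' x y) : k = k' := by
  by_contra hne
  obtain ⟨d, hd⟩ := h.determined
  have hi : IndepFun (fun ω => W ω k) (fun ω => W ω k) μ :=
    ((h'.indepFun hne).comp measurable_id (measurable_of_finite d)).congr (by rfl) hd.symm
  have h1 := hi.finEntropy_prodMk (hW.measurable k) (hW.measurable k)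
  have h2 : finEntropy μ (fun ω => (W ω k, W ω k)) ≤ finEntropy μ (fun ω => W ω k) :=
    finEntropy_le_of_ae_eq_comp (hW.measurable k) (fun w => (w, w)) (by rfl)
  have h3 := hW.finEntropy_eq k
  have := Real.log_natCast_pos hκ
  linarith

omit [Fintype α] [Fintype β] [MeasurableSingletonClass α] in
-- On the event `x = a, y = b` the message is almost surely the decoded value `d (a, b)`, an event
-- of probability `1 / |κ|` independent of `y`.
lemma measureReal_inter_le (hW : IsUniformFamily μ W) (h : Discloses μ W k x y)
    (hi : IndepFun (fun ω => W ω k) y μ) (a : α) (b : β) :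
    μ.real (x ⁻¹' {a} ∩ y ⁻¹' {b}) ≤ (Fintype.card κ : ℝ)⁻¹ * μ.real (y ⁻¹' {b}) := by
  obtain ⟨d, hd⟩ := h.determined
  rw [← hW.uniform k (d (a, b)), ← hi.measureReal_preimage_prodMk]
  refine ENNReal.toReal_mono (measure_ne_top _ _) (measure_mono_ae ?_)
  filter_upwards [hd] with ω hω
  rintro ⟨h1, h2⟩
  simp only [Set.mem_preimage, Set.mem_singleton_iff] at h1 h2
  show (W ω k, y ω) = _
  rw [hω, h1, h2]

omit [Fintype α] [MeasurableSingletonClass α] in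
lemma measureReal_le (hW : IsUniformFamily μ W) (hy : Measurable y)
    (h : Discloses μ W k x y) (hi : IndepFun (fun ω => W ω k) y μ) (a : α) :
    μ.real (x ⁻¹' {a}) ≤ (Fintype.card κ : ℝ)⁻¹ := by
  rw [← sum_measureReal_preimage_inter hy]
  calc ∑ b, μ.real (y ⁻¹' {b} ∩ x ⁻¹' {a})
      ≤ ∑ b, (Fintype.card κ : ℝ)⁻¹ * μ.real (y ⁻¹' {b}) := by
        refine Finset.sum_le_sum fun b _ => ?_
        rw [Set.inter_comm]
        exact h.measureReal_inter_le hW hi a b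
    _ = _ := by rw [← Finset.mul_sum, sum_measureReal_preimage hy, mul_one]

lemma three_mul_log_le (hW : IsUniformFamily μ W) {x' : Ω → α} {y' : Ω → β} {c l m : ι}
    (hx : Measurable x) (hx' : Measurable x') (hy : Measurable y) (hy' : Measurable y')
    (h₁ : Discloses μ W c x y) (h₂ : Discloses μ W l x' y) (h₃ : Discloses μ W l x y')
    (h₄ : Discloses μ W m x' y') (hcl : c ≠ l) (hcm : c ≠ m) (hlm : l ≠ m) :
    3 * Real.log (Fintype.card κ) ≤ finEntropy μ x + finEntropy μ y := by
  have := finEntropy_add_le_of_disclosure hx hx' hy hy' (hW.measurable l) (hW.measurable c)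
    h₂.determined h₃.determined h₁.determined
    ((h₄.indepFun hlm).comp measurable_id measurable_snd) (h₄.indepFun_pair hlm hcm)
  rw [hW.finEntropy_pair hcl.symm, hW.finEntropy_eq] at this
  linarith

omit [Fintype β] in
/-- If `x` and `y` are functions of `W` and of a variable `R` independent of `W`, no value of `R`
has probability more than `1 / |κ|`. -/
lemma measureReal_randomness_le [Fintype ι] {ρ : Type*} [MeasurableSpace ρ]
    [MeasurableSingletonClass ρ] (hW : IsUniformFamily μ W) (hκ : 2 ≤ Fintype.card κ)
    (hx : Measurable x) (h : Discloses μ W k x y)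
    (hix : IndepFun (fun ω => W ω k) x μ) (hiy : IndepFun (fun ω => W ω k) y μ) {R : Ω → ρ}
    (hR : IndepFun W R μ) (hxR : ∃ f : (ι → κ) → ρ → α, ∀ ω, x ω = f (W ω) (R ω))
    (hyR : ∃ f : (ι → κ) → ρ → β, ∀ ω, y ω = f (W ω) (R ω)) (r : ρ) :
    μ.real (R ⁻¹' {r}) ≤ (Fintype.card κ : ℝ)⁻¹ := by
  classical
  obtain ⟨f, hf⟩ := hxR
  obtain ⟨g, hg⟩ := hyR
  have hne : Nonempty κ := Fintype.card_pos_iff.1 (by omega)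
  let w : ι → κ := fun _ => Classical.arbitrary κ
  have hq : (0 : ℝ) < (Fintype.card κ : ℝ)⁻¹ := by
    rw [inv_pos]; exact_mod_cast Fintype.card_pos
  set q : ℝ := (Fintype.card κ : ℝ)⁻¹
  have e1 := hW.measureReal_preimage_comp Function.injective_id w
  have e2 := hW.measureReal_preimage_comp (Subtype.val_injective (p := fun j => j ≠ k))
    (fun j => w j)
  have e3 := hR.measureReal_preimage_prodMk w r
  have e4 := h.indep.measureReal_preimage_prodMk (fun j => w j) (f w r, g w r)
  -- Once `(W, R) = (w, r)` is known, so are the other messages and both answers. The left side is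
  -- `q ^ |ι| * P(R = r)`, and the right is at most `q ^ (|ι| - 1) * q * q`, with `q = 1 / |κ|`.
  have e5 : μ.real ((fun ω => (W ω, R ω)) ⁻¹' {(w, r)}) ≤
      μ.real ((fun ω => (fun j : {j // j ≠ k} => W ω j, x ω, y ω)) ⁻¹'
        {((fun j => w j : {j // j ≠ k} → κ), f w r, g w r)}) := by
    refine measureReal_mono fun ω hω => ?_
    simp only [Set.mem_preimage, Set.mem_singleton_iff, Prod.mk.injEq] at hω ⊢
    rw [hf, hg, hω.1, hω.2]
    exact ⟨rfl, rfl, rfl⟩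
  have e6 := h.measureReal_inter_le hW hiy (f w r) (g w r)
  have e7 := h.swap.measureReal_le hW hx hix (g w r)
  have e8 : (fun ω => (x ω, y ω)) ⁻¹' {(f w r, g w r)} =
      x ⁻¹' {f w r} ∩ y ⁻¹' {g w r} := by
    rw [← Set.singleton_prod_singleton, Set.mk_preimage_prod]
  have e9 : Fintype.card ι = Fintype.card {j // j ≠ k} + 1 := by
    have := Fintype.card_pos_iff.2 ⟨k⟩
    simp only [ne_eq, Fintype.card_subtype_compl, Fintype.card_unique]
    omega
  change μ.real (W ⁻¹' {w}) = _ at e1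
  rw [e3, e4, e1, e2, e8, e9, pow_succ, mul_assoc] at e5
  replace e5 := le_of_mul_le_mul_left e5 (by positivity)
  have e10 : q * μ.real (y ⁻¹' {g w r}) ≤ q * q := mul_le_mul_of_nonneg_left e7 hq.le
  exact le_of_mul_le_mul_left (e5.trans (e6.trans e10)) hq

end Discloses

end

/-! ### Freezing an independent variable at one of its atoms. -/

section Conditioning

variable {Ω α β γ δ : Type*} [MeasurableSpace Ω] {μ : Measure Ω} [IsProbabilityMeasure μ]
  [MeasurableSpace α] [MeasurableSpace β]

lemma ProbabilityTheory.indepFun_of_singleton [Countable α] [Countable β]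
    [MeasurableSingletonClass α] [MeasurableSingletonClass β] {X : Ω → α} {Y : Ω → β}
    (hX : Measurable X) (hY : Measurable Y)
    (h : ∀ x y, μ (X ⁻¹' {x} ∩ Y ⁻¹' {y}) = μ (X ⁻¹' {x}) * μ (Y ⁻¹' {y})) :
    IndepFun X Y μ := by
  rw [indepFun_iff_map_prod_eq_prod_map_map hX.aemeasurable hY.aemeasurable]
  refine Measure.ext_of_singleton fun p => ?_
  obtain ⟨x, y⟩ := p
  rw [← Set.singleton_prod_singleton, Measure.prod_prod,
    Measure.map_apply (hX.prodMk hY) (.of_discrete), Set.mk_preimage_prod, h,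
    Measure.map_apply hX (measurableSet_singleton x),
    Measure.map_apply hY (measurableSet_singleton y)]

/-- `X ⟂ (Y, Z)` and `Y ⟂ Z` imply `Y ⟂ (X, Z)`. -/
lemma ProbabilityTheory.IndepFun.prodMk_right_comm [MeasurableSpace γ] [Countable α] [Countable β]
    [Countable γ] [MeasurableSingletonClass α] [MeasurableSingletonClass β]
    [MeasurableSingletonClass γ] {X : Ω → α} {Y : Ω → β} {Z : Ω → γ} (hX : Measurable X)
    (hY : Measurable Y) (hZ : Measurable Z) (h : IndepFun X (fun ω => (Y ω, Z ω)) μ)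
    (h' : IndepFun Y Z μ) : IndepFun Y (fun ω => (X ω, Z ω)) μ := by
  refine indepFun_of_singleton hY (hX.prodMk hZ) fun y p => ?_
  obtain ⟨x, z⟩ := p
  have h1 := h.measure_inter_preimage_eq_mul {x} {(y, z)} (measurableSet_singleton _)
    (measurableSet_singleton _)
  have h2 := h'.measure_inter_preimage_eq_mul {y} {z} (measurableSet_singleton _)
    (measurableSet_singleton _)
  have h3 := (h.comp measurable_id measurable_snd).measure_inter_preimage_eq_mul {x} {z}
    (measurableSet_singleton _) (measurableSet_singleton _)
  simp only [← Set.singleton_prod_singleton, Set.mk_preimage_prod] at h1 ⊢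
  change μ (X ⁻¹' {x} ∩ Z ⁻¹' {z}) = μ (X ⁻¹' {x}) * μ (Z ⁻¹' {z}) at h3
  rw [Set.inter_left_comm, h1, h2, h3]
  ring

variable {F : Ω → α} {V : Ω → β} [MeasurableSingletonClass α]

omit [IsProbabilityMeasure μ] in
/-- A property of independent variables `F` and `V` that holds almost surely holds almost surely
when `F` is replaced by one of its atoms. -/
lemma ProbabilityTheory.IndepFun.ae_of_ae [Countable β] [MeasurableSingletonClass β]
    (h : IndepFun F V μ) {p : α → β → Prop} (hp : ∀ᵐ ω ∂μ, p (F ω) (V ω)) {f : α}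
    (hf : μ (F ⁻¹' {f}) ≠ 0) : ∀ᵐ ω ∂μ, p f (V ω) := by
  have h1 := h.measure_inter_preimage_eq_mul {f} {v | ¬ p f v} (measurableSet_singleton f)
    .of_discrete
  have h2 : μ (F ⁻¹' {f} ∩ V ⁻¹' {v | ¬ p f v}) = 0 := by
    refine measure_mono_null (fun ω hω => ?_) hp
    obtain ⟨rfl, h3⟩ := hω
    exact h3
  rw [h2, eq_comm, mul_eq_zero] at h1
  exact h1.resolve_left hf

lemma ProbabilityTheory.IndepFun.cond_real_preimage [Countable β] [MeasurableSingletonClass β]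
    (h : IndepFun F V μ) (hF : Measurable F) {A : Ω → γ} {g : α → β → γ}
    (hA : A =ᵐ[μ] fun ω => g (F ω) (V ω)) {f : α} (hf : μ (F ⁻¹' {f}) ≠ 0) (s : Set γ) :
    (μ[|F ⁻¹' {f}]).real (A ⁻¹' s) = μ.real ((fun ω => g f (V ω)) ⁻¹' s) := by
  have h1 := h.measure_inter_preimage_eq_mul {f} {v | g f v ∈ s} (measurableSet_singleton f)
    .of_discrete
  have h2 : μ (F ⁻¹' {f} ∩ A ⁻¹' s) = μ (F ⁻¹' {f} ∩ V ⁻¹' {v | g f v ∈ s}) := by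
    refine measure_congr ?_
    filter_upwards [hA] with ω hω
    refine propext (and_congr_right ?_)
    rintro rfl
    change A ω ∈ s ↔ _
    rw [hω]
    rfl
  rw [measureReal_def, cond_apply (hF (measurableSet_singleton f)), h2, h1, ← mul_assoc,
    ENNReal.inv_mul_cancel hf (measure_ne_top _ _), one_mul]
  rfl

lemma ProbabilityTheory.IndepFun.shannonEntropy_cond [Countable β] [MeasurableSingletonClass β]
    (h : IndepFun F V μ) (hF : Measurable F) {A : Ω → γ} {g : α → β → γ}
    (hA : A =ᵐ[μ] fun ω => g (F ω) (V ω)) {f : α} (hf : μ (F ⁻¹' {f}) ≠ 0) (b : ℕ) :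
    shannonEntropy (μ[|F ⁻¹' {f}]) b A = shannonEntropy μ b (fun ω => g f (V ω)) := by
  simp only [shannonEntropy, h.cond_real_preimage hF hA hf]

/-- If `(F, A)` is independent of a function of `V`, then conditioning on an atom of `F` preserves
this independence. -/
lemma ProbabilityTheory.IndepFun.freeze [Countable β] [MeasurableSingletonClass β]
    [MeasurableSpace γ] [Countable γ] [MeasurableSingletonClass γ]
    [MeasurableSpace δ] [Countable δ] [MeasurableSingletonClass δ]
    (h : IndepFun F V μ) (hV : Measurable V) {A : Ω → γ} {g : α → β → γ}
    (hA : A =ᵐ[μ] fun ω => g (F ω) (V ω)) {u : β → δ}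
    (hu : IndepFun (fun ω => u (V ω)) (fun ω => (F ω, A ω)) μ) {f : α}
    (hf : μ (F ⁻¹' {f}) ≠ 0) :
    IndepFun (fun ω => u (V ω)) (fun ω => g f (V ω)) μ := by
  refine indepFun_of_singleton (Measurable.of_discrete.comp hV) (Measurable.of_discrete.comp hV)
    fun w x => ?_
  have h1 := h.measure_inter_preimage_eq_mul {f} {v | u v = w ∧ g f v = x}
    (measurableSet_singleton f) .of_discrete
  have h2 := h.measure_inter_preimage_eq_mul {f} {v | g f v = x}
    (measurableSet_singleton f) .of_discrete
  have h3 := hu.measure_inter_preimage_eq_mul {w} ({f} ×ˢ {x}) (measurableSet_singleton w)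
    ((measurableSet_singleton f).prod (measurableSet_singleton x))
  have e : ∀ᵐ ω ∂μ, F ω = f → (A ω = x ↔ g f (V ω) = x) := by
    filter_upwards [hA] with ω hω
    rintro rfl
    rw [hω]
  have e1 : μ ((fun ω => u (V ω)) ⁻¹' {w} ∩ (fun ω => (F ω, A ω)) ⁻¹' ({f} ×ˢ {x})) =
      μ (F ⁻¹' {f} ∩ V ⁻¹' {v | u v = w ∧ g f v = x}) := by
    refine measure_congr ?_
    filter_upwards [e] with ω hω
    change (u (V ω) = w ∧ F ω = f ∧ A ω = x) = (F ω = f ∧ u (V ω) = w ∧ g f (V ω) = x)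
    exact propext ⟨fun hh => ⟨hh.2.1, hh.1, (hω hh.2.1).1 hh.2.2⟩,
      fun hh => ⟨hh.2.1, hh.1, (hω hh.1).2 hh.2.2⟩⟩
  have e2 : μ ((fun ω => (F ω, A ω)) ⁻¹' ({f} ×ˢ {x})) =
      μ (F ⁻¹' {f} ∩ V ⁻¹' {v | g f v = x}) := by
    refine measure_congr ?_
    filter_upwards [e] with ω hω
    exact propext (and_congr_right hω)
  rw [e1, e2, h1, h2, mul_left_comm] at h3
  exact (ENNReal.mul_right_inj hf (measure_ne_top _ _)).1 h3

end Conditioning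

/-! ### Independence and deterministic functions extracted from a scheme. -/

namespace RetrievalScheme

section General

variable {𝔽 : Type} [Fintype 𝔽] [Nontrivial 𝔽] [MeasurableSpace 𝔽] [DiscreteMeasurableSpace 𝔽]
  {N K L : ℕ} (s : RetrievalScheme 𝔽 N K L)

omit [Nontrivial 𝔽] [DiscreteMeasurableSpace 𝔽] in
lemma indepFun_W : IndepFun s.W (fun ω => (s.F ω, s.R ω)) s.μ :=
  (mutualInfo_eq_zero_iff s.measurable_W (s.measurable_F.prodMk s.measurable_R)).1 s.message_indep

omit [Nontrivial 𝔽] [DiscreteMeasurableSpace 𝔽] in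
lemma indepFun_W_R : IndepFun s.W s.R s.μ := s.indepFun_W.comp measurable_id measurable_snd

omit [Nontrivial 𝔽] in
lemma indepFun_F : IndepFun s.F (fun ω => (s.W ω, s.R ω)) s.μ :=
  s.indepFun_W.prodMk_right_comm s.measurable_W s.measurable_F s.measurable_R
    ((mutualInfo_eq_zero_iff s.measurable_F s.measurable_R).1 s.randomness_indep)

lemma isUniformFamily_W : IsUniformFamily s.μ s.W := by
  have : IsProbabilityMeasure (uniformOn (Set.univ : Set (Fin L → 𝔽))) :=
    isProbabilityMeasure_uniformOn Set.finite_univ Set.univ_nonempty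
  have mW : ∀ j, Measurable fun ω => s.W ω j := fun j =>
    (measurable_pi_apply j).comp s.measurable_W
  have h : s.μ.map s.W = Measure.pi fun _ : Fin K => uniformOn (Set.univ : Set (Fin L → 𝔽)) := by
    rw [s.message_uniform, ← uniformOn_pi, Set.pi_univ]
  have h1 : ∀ j, s.μ.map (fun ω => s.W ω j) = uniformOn Set.univ := fun j => by
    have e := (measurePreserving_eval (fun _ : Fin K =>
      uniformOn (Set.univ : Set (Fin L → 𝔽))) j).map_eq
    rw [← h, Measure.map_map (measurable_pi_apply j) s.measurable_W] at e
    exact e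
  refine ⟨mW, ?_, fun j w => ?_⟩
  · rw [iIndepFun_iff_map_fun_eq_pi_map fun j => (mW j).aemeasurable]
    simp_rw [h1]
    exact h
  · rw [measureReal_def, ← Measure.map_apply (mW j) (measurableSet_singleton w), h1,
      uniformOn_univ]
    simp

omit [DiscreteMeasurableSpace 𝔽] in
lemma exists_query : ∃ q : ∀ n, Fin K → s.FAlph → s.Query n,
    ∀ n k, s.Q n k =ᵐ[s.μ] fun ω => q n k (s.F ω) := by
  have h : ∀ k, ∃ f : s.FAlph → ∀ n, s.Query n,
      (fun ω n => s.Q n k ω) =ᵐ[s.μ] fun ω => f (s.F ω) := fun k =>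
    ae_eq_comp_of_condShannonEntropy_eq_zero (measurable_pi_iff.2 fun n => s.measurable_Q n k)
      s.measurable_F Fintype.one_lt_card (s.deterministic_query k)
  choose f hf using h
  refine ⟨fun n k a => f k a n, fun n k => ?_⟩
  filter_upwards [hf k] with ω hω
  exact congrFun hω n

/-- Determinism alone would allow an answer function depending on the desired index. User privacy
transports the one for index `0` to every `k`, so an answer depends on the query only. -/
lemma exists_answer [NeZero K] (hs : s.UserPrivate) :
    ∃ g : ∀ n, s.Query n → (Fin K → Fin L → 𝔽) → s.RAlph → s.Answer n,
      ∀ n k, s.A n k =ᵐ[s.μ] fun ω => g n (s.Q n k ω) (s.W ω) (s.R ω) := by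
  have h : ∀ n, ∃ f : s.Query n × (Fin K → Fin L → 𝔽) × s.RAlph → s.Answer n,
      s.A n 0 =ᵐ[s.μ] fun ω => f (s.Q n 0 ω, s.W ω, s.R ω) := fun n =>
    ae_eq_comp_of_condShannonEntropy_eq_zero (s.measurable_A n 0)
      ((s.measurable_Q n 0).prodMk (s.measurable_W.prodMk s.measurable_R)) Fintype.one_lt_card
      (s.deterministic_answer n 0)
  choose f hf using h
  refine ⟨fun n a w r => f n (a, w, r), fun n k => ?_⟩
  exact (hs n 0 k).ae_snd (p := fun t => t.2.1 = f n (t.1, t.2.2.1, t.2.2.2)) .of_discrete (hf n)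

end General

end RetrievalScheme

/-! ### Combinatorics of three couplings with disjoint supports. -/

/-- Three couplings of the same marginals `p` and `r` with pairwise disjoint supports. -/
structure DisjointCouplings {α β : Type*} [Fintype α] [Fintype β] (J : Fin 3 → α → β → ℝ)
    (p : α → ℝ) (r : β → ℝ) : Prop where
  nonneg : ∀ k a b, 0 ≤ J k a b
  sum_right : ∀ k a, ∑ b, J k a b = p a
  sum_left : ∀ k b, ∑ a, J k a b = r b
  sum_eq_one : ∑ b, r b = 1
  disjoint : ∀ {k l a b}, 0 < J k a b → 0 < J l a b → k = l

namespace DisjointCouplings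

variable {α β : Type*} [Fintype α] [Fintype β] {J : Fin 3 → α → β → ℝ} {p : α → ℝ} {r : β → ℝ}

lemma sum_eq_one' (h : DisjointCouplings J p r) : ∑ a, p a = 1 := by
  simp_rw [← h.sum_eq_one, ← h.sum_right 0, ← h.sum_left 0]
  exact Finset.sum_comm

lemma swap (h : DisjointCouplings J p r) : DisjointCouplings (fun k b a => J k a b) r p :=
  ⟨fun k b a => h.nonneg k a b, h.sum_left, h.sum_right, h.sum_eq_one', h.disjoint⟩

lemma le_left (h : DisjointCouplings J p r) (k : Fin 3) (a : α) (b : β) : J k a b ≤ p a := by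
  rw [← h.sum_right k a]
  exact Finset.single_le_sum (fun b _ => h.nonneg k a b) (Finset.mem_univ b)

lemma le_right (h : DisjointCouplings J p r) (k : Fin 3) (a : α) (b : β) : J k a b ≤ r b :=
  h.swap.le_left k b a

/-- Each coupling puts the positive mass `r b` on column `b`, and disjointness makes the three rows
found distinct. -/
lemma exists_column (h : DisjointCouplings J p r) {b : β} (hb : 0 < r b) :
    ∃ φ : Fin 3 → α, φ.Injective ∧ ∀ k, 0 < J k (φ k) b := by
  have : ∀ k, ∃ a, 0 < J k a b := fun k => by
    by_contra! hc
    have := h.sum_left k b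
    have := Finset.sum_nonpos fun a (_ : a ∈ Finset.univ) => hc a
    linarith
  choose φ hφ using this
  exact ⟨φ, fun k l hkl => h.disjoint (hφ k) (hkl ▸ hφ l), hφ⟩

lemma exists_pos (h : DisjointCouplings J p r) : ∃ b, 0 < r b := by
  by_contra! hc
  have := Finset.sum_nonpos fun b (_ : b ∈ Finset.univ) => hc b
  linarith [h.sum_eq_one]

lemma image_subset [DecidableEq α] (h : DisjointCouplings J p r) {b : β} {φ : Fin 3 → α}
    (hφ : ∀ k, 0 < J k (φ k) b) :
    Finset.univ.image φ ⊆ Finset.univ.filter fun a => 0 < p a := by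
  intro a ha
  obtain ⟨k, -, rfl⟩ := Finset.mem_image.1 ha
  simpa using (hφ k).trans_le (h.le_left k _ b)

lemma three_le_card (h : DisjointCouplings J p r) :
    3 ≤ (Finset.univ.filter fun a => 0 < p a).card := by
  classical
  obtain ⟨b, hb⟩ := h.exists_pos
  obtain ⟨φ, hi, hφ⟩ := h.exists_column hb
  have := Finset.card_le_card (h.image_subset hφ)
  rwa [Finset.card_image_of_injective _ hi, Finset.card_univ, Fintype.card_fin] at this

lemma exists_apply_eq (h : DisjointCouplings J p r)
    (h3 : (Finset.univ.filter fun a => 0 < p a).card = 3) {b : β} {φ : Fin 3 → α}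
    (hi : φ.Injective) (hφ : ∀ k, 0 < J k (φ k) b) {a : α} (ha : 0 < p a) : ∃ k, φ k = a := by
  classical
  have := Finset.eq_of_subset_of_card_le (h.image_subset hφ) (by
    rw [h3, Finset.card_image_of_injective _ hi, Finset.card_univ, Fintype.card_fin])
  have ha' : a ∈ Finset.univ.image φ := by rw [this]; simpa using ha
  simpa using ha'

/-- With only three rows in the support, each column is a bijection between labels and rows. -/
lemma apply_eq_of_pos (h : DisjointCouplings J p r)
    (h3 : (Finset.univ.filter fun a => 0 < p a).card = 3) {b : β} {φ : Fin 3 → α}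
    (hi : φ.Injective) (hφ : ∀ k, 0 < J k (φ k) b) {k : Fin 3} {a : α} (ha : 0 < J k a b) :
    φ k = a := by
  obtain ⟨l, rfl⟩ := h.exists_apply_eq h3 hi hφ (ha.trans_le (h.le_left k a b))
  rw [h.disjoint (hφ l) ha]

/-- When the support of `p` has three elements, every cell `(a, b)` is completed by a `2 × 2`
square `{a, a'} × {b, b'}` whose two off-diagonal cells have the same label, and whose
diagonal cells have different labels. -/
lemma exists_square (h : DisjointCouplings J p r)
    (h3 : (Finset.univ.filter fun a => 0 < p a).card = 3) {c : Fin 3} {a : α} {b : β}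
    (hc : 0 < J c a b) : ∃ l m a' b', c ≠ l ∧ c ≠ m ∧ l ≠ m ∧ 0 < J l a' b ∧ 0 < J l a b' ∧
      0 < J m a' b' := by
  have hlab : ∀ c : Fin 3, ∃ l m : Fin 3, c ≠ l ∧ c ≠ m ∧ l ≠ m ∧ ∀ k, k = c ∨ k = l ∨ k = m := by
    decide
  obtain ⟨φ, hi, hφ⟩ := h.exists_column (hc.trans_le (h.le_right c a b))
  obtain rfl := h.apply_eq_of_pos h3 hi hφ hc
  obtain ⟨l, m, hcl, hcm, hlm, hall⟩ := hlab c
  refine ⟨l, m, φ l, ?_⟩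
  by_contra! hno
  -- If no square exists, at most one of the cells `(φ c, l)`, `(φ l, m)`, `(φ m, c)` can occur in a
  -- column: in a three-row column any two of them force the third, and the first two together make
  -- a square.
  have hno' : ∀ b', 0 < J l (φ c) b' → 0 < J m (φ l) b' → False := fun b' h1 h2 =>
    absurd (hno b' hcl hcm hlm (hφ l) h1) (not_le.2 h2)
  have hcol : ∀ b', 0 < r b' → J l (φ c) b' + J m (φ l) b' + J c (φ m) b' ≤ r b' := by
    intro b' hb'
    obtain ⟨ψ, hi', hψ⟩ := h.exists_column hb'
    have hall' : ∀ k, ψ k = φ c ∨ ψ k = φ l ∨ ψ k = φ m := fun k => by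
      obtain ⟨j, hj⟩ := h.exists_apply_eq h3 hi hφ ((hψ k).trans_le (h.le_left k _ b'))
      rcases hall j with rfl | rfl | rfl <;> simp [hj]
    have n1 := h.nonneg l (φ c) b'
    have n2 := h.nonneg m (φ l) b'
    have n3 := h.nonneg c (φ m) b'
    have u1 := h.le_right l (φ c) b'
    have u2 := h.le_right m (φ l) b'
    have u3 := h.le_right c (φ m) b'
    have z13 : 0 < J l (φ c) b' → 0 < J c (φ m) b' → False := fun h1 h2 => by
      have e1 := h.apply_eq_of_pos h3 hi' hψ h1
      have e2 := h.apply_eq_of_pos h3 hi' hψ h2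
      rcases hall' m with e | e | e
      · exact hlm (hi' (e1.trans e.symm))
      · exact hno' b' h1 (e ▸ hψ m)
      · exact hcm (hi' (e2.trans e.symm))
    have z23 : 0 < J m (φ l) b' → 0 < J c (φ m) b' → False := fun h1 h2 => by
      have e1 := h.apply_eq_of_pos h3 hi' hψ h1
      have e2 := h.apply_eq_of_pos h3 hi' hψ h2
      rcases hall' l with e | e | e
      · exact hno' b' (e ▸ hψ l) h1
      · exact hlm (hi' (e.trans e1.symm))
      · exact hcl (hi' (e2.trans e.symm))
    rcases n1.eq_or_lt with h1 | h1
    · rcases n2.eq_or_lt with h2 | h2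
      · linarith
      · have := not_lt.1 (z23 h2); linarith
    · have := not_lt.1 (hno' b' h1)
      have := not_lt.1 (z13 h1)
      linarith
  have hzero : ∀ {k j}, k ≠ j → J k (φ j) b = 0 := fun {k j} hkj => by
    by_contra hne
    exact hkj (h.disjoint ((h.nonneg k (φ j) b).lt_of_ne' hne) (hφ j))
  -- The inequality is strict at `b`, whose column pairs each row `φ k` with label `k`, so all three
  -- cells vanish there. Summed over columns the left side is the full row mass, so this reads `1 <
  -- 1`.
  have hsum : ∑ b', (J l (φ c) b' + J m (φ l) b' + J c (φ m) b') < ∑ b', r b' := by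
    refine Finset.sum_lt_sum (fun b' _ => ?_) ⟨b, Finset.mem_univ b, ?_⟩
    · by_cases hb' : 0 < r b'
      · exact hcol b' hb'
      · linarith [h.le_right l (φ c) b', h.le_right m (φ l) b', h.le_right c (φ m) b',
          h.nonneg l (φ c) b', h.nonneg m (φ l) b', h.nonneg c (φ m) b']
    · rw [hzero hcl.symm, hzero hlm.symm, hzero hcm]
      have := hc.trans_le (h.le_right c _ b)
      linarith
  simp only [Finset.sum_add_distrib, h.sum_right] at hsum
  rw [h.sum_eq_one, ← h.sum_eq_one'] at hsum
  refine absurd hsum (not_lt.2 ?_)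
  classical
  have hsub : ∑ a ∈ ({φ c, φ l, φ m} : Finset α), p a = p (φ c) + p (φ l) + p (φ m) := by
    rw [Finset.sum_insert (by simp [hi.eq_iff, hcl, hcm]), Finset.sum_pair (hi.ne hlm), add_assoc]
  rw [← hsub]
  refine le_of_eq (Finset.sum_subset (Finset.subset_univ _) fun a _ ha => ?_).symm
  by_contra hne
  have hpa : 0 < p a := by
    refine lt_of_le_of_ne ?_ (Ne.symm hne)
    rw [← h.sum_right 0]
    exact Finset.sum_nonneg fun b _ => h.nonneg 0 a b
  obtain ⟨j, rfl⟩ := h.exists_apply_eq h3 hi hφ hpa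
  rcases hall j with rfl | rfl | rfl <;> simp at ha

end DisjointCouplings

/-! ### The converse bounds. -/

namespace RetrievalScheme

variable {𝔽 : Type} [Fintype 𝔽] [Nontrivial 𝔽] [MeasurableSpace 𝔽] [DiscreteMeasurableSpace 𝔽]

/-- The answer of database `n` to the query `a`, given the answer functions `g`. -/
def answerTo {N K L : ℕ} (s : RetrievalScheme 𝔽 N K L)
    (g : ∀ n, s.Query n → (Fin K → Fin L → 𝔽) → s.RAlph → s.Answer n) (n : Fin N)
    (a : s.Query n) (ω : s.Ω) : s.Answer n :=
  g n a (s.W ω) (s.R ω)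

omit [Nontrivial 𝔽] in
lemma measurable_answerTo {N K L : ℕ} (s : RetrievalScheme 𝔽 N K L)
    (g : ∀ n, s.Query n → (Fin K → Fin L → 𝔽) → s.RAlph → s.Answer n) (n : Fin N)
    (a : s.Query n) : Measurable (s.answerTo g n a) :=
  (Measurable.of_discrete (f := fun v : (Fin K → Fin L → 𝔽) × s.RAlph => g n a v.1 v.2)).comp
    (s.measurable_W.prodMk s.measurable_R)

omit [Nontrivial 𝔽] in
/-- Each possible pair of queries for message `k` discloses message `k` and nothing else. -/
lemma discloses_of_atom {K L : ℕ} (s : RetrievalScheme 𝔽 2 K L) (hs : s.IsSPIR)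
    (hb : 2 ≤ Fintype.card 𝔽)
    {g : ∀ n, s.Query n → (Fin K → Fin L → 𝔽) → s.RAlph → s.Answer n}
    (hg : ∀ n k, s.A n k =ᵐ[s.μ] fun ω => g n (s.Q n k ω) (s.W ω) (s.R ω))
    {q : ∀ n, Fin K → s.FAlph → s.Query n}
    (hq : ∀ n k, s.Q n k =ᵐ[s.μ] fun ω => q n k (s.F ω)) (k : Fin K) {f : s.FAlph}
    (hf : s.μ (s.F ⁻¹' {f}) ≠ 0) :
    Discloses s.μ s.W k (s.answerTo g 0 (q 0 k f)) (s.answerTo g 1 (q 1 k f)) := by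
  have hA : (fun ω n => s.A n k ω) =ᵐ[s.μ]
      fun ω n => g n (q n k (s.F ω)) (s.W ω) (s.R ω) := by
    filter_upwards [ae_all_iff.2 fun n => hg n k, ae_all_iff.2 fun n => hq n k] with ω h1 h2
    funext n
    rw [h1, h2]
  have mA : Measurable fun ω n => s.A n k ω := measurable_pi_iff.2 fun n => s.measurable_A n k
  have mW : ∀ j, Measurable fun ω => s.W ω j := fun j =>
    (measurable_pi_apply j).comp s.measurable_W
  constructor
  · obtain ⟨d, hd⟩ := ae_eq_comp_of_condShannonEntropy_eq_zero (mW k)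
      (s.measurable_F.prodMk mA) hb (hs.reliable k)
    have h1 := s.indepFun_F.ae_of_ae (p := fun a v => v.1 k = d (a, fun n => g n (q n k a) v.1 v.2))
      (by filter_upwards [hd, hA] with ω h1 h2
          rw [h1]
          exact congrArg (fun z => d (s.F ω, z)) h2) hf
    refine ⟨fun z => d (f, (piFinTwoEquiv s.Answer).symm z), ?_⟩
    filter_upwards [h1] with ω hω
    rw [hω]
    exact congrArg (fun z => d (f, z)) ((piFinTwoEquiv s.Answer).symm_apply_apply
      fun n => g n (q n k f) (s.W ω) (s.R ω)).symm
  · have h1 := (mutualInfo_eq_zero_iff (measurable_pi_iff.2 fun j => mW _)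
      (s.measurable_F.prodMk mA)).1 (hs.databasePrivate k)
    have h2 := s.indepFun_F.freeze (s.measurable_W.prodMk s.measurable_R)
      (g := fun a v n => g n (q n k a) v.1 v.2) hA
      (u := fun v (j : {j // j ≠ k}) => v.1 j) h1 hf
    exact h2.comp measurable_id
      (Measurable.of_discrete (f := fun z : ∀ n, s.Answer n => (z 0, z 1)))

omit [Nontrivial 𝔽] in
-- Given an atom of `F`, the answer has the law of the response to the frozen query, so the
-- conditional entropies are averages over atoms and a bound on each atom suffices.
lemma le_answerEntropy {K L : ℕ} (s : RetrievalScheme 𝔽 2 K L)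
    {g : ∀ n, s.Query n → (Fin K → Fin L → 𝔽) → s.RAlph → s.Answer n}
    (hg : ∀ n k, s.A n k =ᵐ[s.μ] fun ω => g n (s.Q n k ω) (s.W ω) (s.R ω))
    {q : ∀ n, Fin K → s.FAlph → s.Query n}
    (hq : ∀ n k, s.Q n k =ᵐ[s.μ] fun ω => q n k (s.F ω)) (k : Fin K) {t : ENNReal}
    (h : ∀ f, s.μ (s.F ⁻¹' {f}) ≠ 0 →
      t ≤ shannonEntropy s.μ (Fintype.card 𝔽) (s.answerTo g 0 (q 0 k f)) +
        shannonEntropy s.μ (Fintype.card 𝔽) (s.answerTo g 1 (q 1 k f))) :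
    t ≤ s.answerEntropy k := by
  rw [answerEntropy, Fin.sum_univ_two, condShannonEntropy, condShannonEntropy, ← ENNReal.tsum_add,
    ← one_mul t, ← tsum_measure_preimage_eq_one (μ := s.μ) s.measurable_F,
    ← ENNReal.tsum_mul_right]
  refine ENNReal.tsum_le_tsum fun f => ?_
  by_cases hf : s.μ (s.F ⁻¹' {f}) = 0
  · simp [hf]
  have hc : ∀ n, shannonEntropy (s.μ[|s.F ⁻¹' {f}]) (Fintype.card 𝔽) (s.A n k) =
      shannonEntropy s.μ (Fintype.card 𝔽) (s.answerTo g n (q n k f)) := fun n =>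
    s.indepFun_F.shannonEntropy_cond s.measurable_F
      (g := fun a v => g n (q n k a) v.1 v.2)
      (by filter_upwards [hg n k, hq n k] with ω h1 h2
          rw [h1, h2]) hf _
  rw [hc, hc, ← mul_add]
  exact mul_le_mul_right (h f hf) _

omit [Nontrivial 𝔽] [DiscreteMeasurableSpace 𝔽] in
lemma condShannonEntropy_answer_le {N K L : ℕ} (s : RetrievalScheme 𝔽 N K L) (n : Fin N)
    (k : Fin K) : condShannonEntropy s.μ (Fintype.card 𝔽) (s.A n k) s.F ≤
      ENNReal.ofReal (Real.logb (Fintype.card 𝔽) (Fintype.card (s.Answer n))) := by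
  rw [condShannonEntropy, ← one_mul (ENNReal.ofReal _), ← tsum_measure_preimage_eq_one (μ := s.μ) s.measurable_F,
    ← ENNReal.tsum_mul_right]
  refine ENNReal.tsum_le_tsum fun f => ?_
  by_cases hf : s.μ (s.F ⁻¹' {f}) = 0
  · simp [hf]
  refine mul_le_mul_right ?_ _
  have := cond_isProbabilityMeasure hf
  have hne : Nonempty s.Ω := nonempty_of_isProbabilityMeasure s.μ
  have : Nonempty (s.Answer n) := ⟨s.A n k hne.some⟩
  rw [shannonEntropy_eq_finEntropy, Real.logb]
  exact ENNReal.ofReal_le_ofReal (div_le_div_of_nonneg_right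
    (finEntropy_le_log_card (s.measurable_A n k)) (Real.log_natCast_nonneg _))

omit [DiscreteMeasurableSpace 𝔽] in
lemma answerEntropy_le {N K L : ℕ} (s : RetrievalScheme 𝔽 N K L) (k : Fin K) :
    s.answerEntropy k ≤ ENNReal.ofReal s.downloadCost := by
  have hne : Nonempty s.Ω := nonempty_of_isProbabilityMeasure s.μ
  rw [downloadCost, ENNReal.ofReal_sum_of_nonneg]
  · exact Finset.sum_le_sum fun n _ => s.condShannonEntropy_answer_le n k
  · intro n _
    have : Nonempty (s.Answer n) := ⟨s.A n k hne.some⟩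
    exact Real.logb_nonneg (by exact_mod_cast Fintype.one_lt_card)
      (by exact_mod_cast Fintype.card_pos)

/-- The joint law of the two queries for message `k`. -/
def queryLaw {K L : ℕ} (s : RetrievalScheme 𝔽 2 K L) (k : Fin K) (a : s.Query 0)
    (b : s.Query 1) : ℝ :=
  s.μ.real (s.Q 1 k ⁻¹' {b} ∩ s.Q 0 k ⁻¹' {a})

omit [Nontrivial 𝔽] [DiscreteMeasurableSpace 𝔽] in
lemma queryLaw_pos {K L : ℕ} (s : RetrievalScheme 𝔽 2 K L)
    {q : ∀ n, Fin K → s.FAlph → s.Query n}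
    (hq : ∀ n k, s.Q n k =ᵐ[s.μ] fun ω => q n k (s.F ω)) (k : Fin K) {f : s.FAlph}
    (hf : s.μ (s.F ⁻¹' {f}) ≠ 0) : 0 < s.queryLaw k (q 0 k f) (q 1 k f) := by
  refine (ENNReal.toReal_pos hf (measure_ne_top _ _)).trans_le ?_
  refine ENNReal.toReal_mono (measure_ne_top _ _) (measure_mono_ae ?_)
  filter_upwards [hq 0 k, hq 1 k] with ω h0 h1
  rintro rfl
  exact ⟨h1, h0⟩

omit [Nontrivial 𝔽] [DiscreteMeasurableSpace 𝔽] in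
-- Since `F` is discrete, it almost surely takes a value of positive probability.
lemma exists_atom_of_queryLaw_pos {K L : ℕ} (s : RetrievalScheme 𝔽 2 K L)
    {q : ∀ n, Fin K → s.FAlph → s.Query n}
    (hq : ∀ n k, s.Q n k =ᵐ[s.μ] fun ω => q n k (s.F ω)) {k : Fin K} {a : s.Query 0}
    {b : s.Query 1} (h : 0 < s.queryLaw k a b) :
    ∃ f, s.μ (s.F ⁻¹' {f}) ≠ 0 ∧ q 0 k f = a ∧ q 1 k f = b := by
  by_contra! hc
  have h0 : ∀ᵐ ω ∂s.μ, s.μ (s.F ⁻¹' {s.F ω}) ≠ 0 := by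
    have : s.μ (⋃ f ∈ {f | s.μ (s.F ⁻¹' {f}) = 0}, s.F ⁻¹' {f}) = 0 :=
      (measure_biUnion_null_iff (Set.to_countable _)).2 fun f hf => hf
    refine measure_mono_null (fun ω hω => ?_) this
    simp only [Set.mem_iUnion]
    exact ⟨s.F ω, not_not.1 hω, rfl⟩
  refine h.ne' ?_
  rw [queryLaw, measureReal_eq_zero_iff, measure_eq_zero_iff_ae_notMem]
  filter_upwards [h0, hq 0 k, hq 1 k] with ω h1 h2 h3 h4
  exact hc _ h1 (h2.symm.trans h4.2) (h3.symm.trans h4.1)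

omit [Nontrivial 𝔽] [DiscreteMeasurableSpace 𝔽] in
lemma queryMarginal_eq {N K L : ℕ} (s : RetrievalScheme 𝔽 N K L) (hs : s.UserPrivate) (n : Fin N)
    (k k' : Fin K) (a : s.Query n) : s.μ.real (s.Q n k ⁻¹' {a}) = s.μ.real (s.Q n k' ⁻¹' {a}) :=
  congrArg ENNReal.toReal (((hs n k k').comp measurable_fst).measure_mem_eq
    (measurableSet_singleton a))

variable (s : RetrievalScheme 𝔽 2 3 1)

/-- The two alternatives of the converse, together with the bound on the randomness. -/
theorem converse (hs : s.IsSPIR) : 1 ≤ s.commonRandomness ∧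
    ((2 * Real.logb 2 3 ≤ s.uploadCost ∧ ∀ k, 3 ≤ s.answerEntropy k) ∨
      (4 ≤ s.uploadCost ∧ ∀ k, 2 ≤ s.answerEntropy k)) := by
  obtain ⟨g, hg⟩ := s.exists_answer hs.userPrivate
  obtain ⟨q, hq⟩ := s.exists_query
  have hb : 2 ≤ Fintype.card 𝔽 := Fintype.one_lt_card
  have hW := s.isUniformFamily_W
  have hcard : Fintype.card (Fin 1 → 𝔽) = Fintype.card 𝔽 := by simp
  have hκ : 2 ≤ Fintype.card (Fin 1 → 𝔽) := hcard ▸ hb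
  have mX := s.measurable_answerTo g
  have edge : ∀ {k a b}, 0 < s.queryLaw k a b →
      Discloses s.μ s.W k (s.answerTo g 0 a) (s.answerTo g 1 b) := fun {k a b} h => by
    obtain ⟨f, hf, rfl, rfl⟩ := s.exists_atom_of_queryLaw_pos hq h
    exact s.discloses_of_atom hs hb hg hq k hf
  have hJ : DisjointCouplings s.queryLaw (fun a => s.μ.real (s.Q 0 0 ⁻¹' {a}))
      (fun b => s.μ.real (s.Q 1 0 ⁻¹' {b})) := by
    refine ⟨fun k a b => measureReal_nonneg, fun k a => ?_, fun k b => ?_,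
      sum_measureReal_preimage (s.measurable_Q 1 0),
      fun h h' => (edge h).index_unique hW hκ (edge h')⟩
    · rw [s.queryMarginal_eq hs.userPrivate 0 0 k]
      exact sum_measureReal_preimage_inter (s.measurable_Q 1 k) _
    · rw [s.queryMarginal_eq hs.userPrivate 1 0 k]
      simp_rw [queryLaw, Set.inter_comm (s.Q 1 k ⁻¹' {b})]
      exact sum_measureReal_preimage_inter (s.measurable_Q 0 k) _
  have other : ∀ k : Fin 3, ∃ k', k ≠ k' := by decide
  -- The query `b` also lies on an edge with some label `k' ≠ k`, whose answers are independent of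
  -- `W k`.
  have hright : ∀ {k a b}, 0 < s.queryLaw k a b →
      IndepFun (fun ω => s.W ω k) (s.answerTo g 1 b) s.μ := fun {k a b} h => by
    obtain ⟨k', hk⟩ := other k
    obtain ⟨φ, -, hφ⟩ := hJ.exists_column (h.trans_le (hJ.le_right k a b))
    exact ((edge (hφ k')).indepFun hk).comp measurable_id measurable_snd
  have hleft : ∀ {k a b}, 0 < s.queryLaw k a b →
      IndepFun (fun ω => s.W ω k) (s.answerTo g 0 a) s.μ := fun {k a b} h => by
    obtain ⟨k', hk⟩ := other k
    obtain ⟨φ, -, hφ⟩ := hJ.swap.exists_column (h.trans_le (hJ.le_left k a b))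
    exact ((edge (hφ k')).indepFun hk).comp measurable_id measurable_fst
  have two_le : ∀ k, 2 ≤ s.answerEntropy k := fun k =>
    s.le_answerEntropy hg hq k fun f hf => by
      have h := s.queryLaw_pos hq k hf
      rw [← one_add_one_eq_two]
      refine add_le_add (one_le_shannonEntropy (mX 0 _) hb ?_)
        (one_le_shannonEntropy (mX 1 _) hb ?_)
      · rw [← hcard]
        exact (edge h).measureReal_le hW (mX 1 _) (hright h)
      · rw [← hcard]
        exact (edge h).swap.measureReal_le hW (mX 0 _) (hleft h)
  have three_le : (∀ k a b, 0 < s.queryLaw k a b → 3 * Real.log (Fintype.card (Fin 1 → 𝔽)) ≤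
      finEntropy s.μ (s.answerTo g 0 a) + finEntropy s.μ (s.answerTo g 1 b)) →
      ∀ k, 3 ≤ s.answerEntropy k := fun hall k =>
    s.le_answerEntropy hg hq k fun f hf => by
      have h := hall k _ _ (s.queryLaw_pos hq k hf)
      have hl := Real.log_natCast_pos hb
      rw [shannonEntropy_eq_finEntropy, shannonEntropy_eq_finEntropy,
        ← ENNReal.ofReal_add (div_nonneg finEntropy_nonneg hl.le)
          (div_nonneg finEntropy_nonneg hl.le), ← add_div]
      rw [hcard] at h
      have h3 : (3 : ENNReal) = ENNReal.ofReal 3 := by simp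
      rw [h3]
      exact ENNReal.ofReal_le_ofReal ((le_div_iff₀ hl).2 h)
  refine ⟨?_, ?_⟩
  · obtain ⟨b, hb0⟩ := hJ.exists_pos
    obtain ⟨φ, -, hφ⟩ := hJ.exists_column hb0
    refine one_le_shannonEntropy s.measurable_R hb fun r => ?_
    rw [← hcard]
    exact (edge (hφ 0)).measureReal_randomness_le hW hκ (mX 0 _) (hleft (hφ 0)) (hright (hφ 0))
      s.indepFun_W_R ⟨g 0 (φ 0), fun _ => rfl⟩ ⟨g 1 b, fun _ => rfl⟩ r
  have upload : ∀ c : ℕ, 0 < c → (c ≤ Fintype.card (s.Query 0)) → c ≤ Fintype.card (s.Query 1) →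
      2 * Real.logb 2 c ≤ s.uploadCost := fun c hc h0 h1 => by
    have hlog : ∀ m : ℕ, c ≤ m → Real.logb 2 c ≤ Real.logb 2 m := fun m hm =>
      Real.logb_le_logb_of_le (by norm_num) (by exact_mod_cast hc) (by exact_mod_cast hm)
    rw [uploadCost, Fin.sum_univ_two]
    linarith [hlog _ h0, hlog _ h1]
  have c0 := hJ.three_le_card
  have c1 := hJ.swap.three_le_card
  have d0 := Finset.card_le_univ (Finset.univ.filter fun a => 0 < s.μ.real (s.Q 0 0 ⁻¹' {a}))
  have d1 := Finset.card_le_univ (Finset.univ.filter fun b => 0 < s.μ.real (s.Q 1 0 ⁻¹' {b}))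
  have upload3 : 2 * Real.logb 2 3 ≤ s.uploadCost := by
    exact_mod_cast upload 3 (by norm_num) (c0.trans d0) (c1.trans d1)
  rcases c0.eq_or_lt with e0 | e0
  · refine Or.inl ⟨upload3, three_le fun k a b h => ?_⟩
    obtain ⟨l, m, a', b', hcl, hcm, hlm, h1, h2, h3⟩ := hJ.exists_square e0.symm h
    exact (edge h).three_mul_log_le hW (mX 0 _) (mX 0 _) (mX 1 _) (mX 1 _) (edge h1) (edge h2)
      (edge h3) hcl hcm hlm
  -- The transposed case: the roles of the databases are exchanged, hence the two off-diagonal edges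
  -- `h1` and `h2` trade places.
  rcases c1.eq_or_lt with e1 | e1
  · refine Or.inl ⟨upload3, three_le fun k a b h => ?_⟩
    obtain ⟨l, m, b', a', hcl, hcm, hlm, h1, h2, h3⟩ := hJ.swap.exists_square e1.symm h
    exact (edge h).three_mul_log_le hW (mX 0 _) (mX 0 _) (mX 1 _) (mX 1 _) (edge h2) (edge h1)
      (edge h3) hcl hcm hlm
  · refine Or.inr ⟨?_, two_le⟩
    have h4 := upload 4 (by norm_num) (le_trans e0 d0) (le_trans e1 d1)
    have : Real.logb 2 ((4 : ℕ) : ℝ) = 2 := by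
      rw [show ((4 : ℕ) : ℝ) = 2 ^ 2 by norm_num, Real.logb_pow]
      simp
    linarith

omit [DiscreteMeasurableSpace 𝔽] in
-- Positivity of `t` is needed because `ENNReal.ofReal` sends all nonpositive reals to `0`.
lemma downloadCost_ge {t : ℝ} (ht : 0 < t) {k : Fin 3}
    (h : ENNReal.ofReal t ≤ s.answerEntropy k) : t ≤ s.downloadCost :=
  (ENNReal.ofReal_le_ofReal_iff'.1 (h.trans (s.answerEntropy_le k))).resolve_right (not_le.2 ht)

end RetrievalScheme

/-! ### Uniform measures and bijections. -/

section Uniform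

variable {Ω α β : Type*} [Fintype Ω] [MeasurableSpace Ω] [DiscreteMeasurableSpace Ω]
  [Fintype α] [MeasurableSpace α] [DiscreteMeasurableSpace α]
  [Fintype β] [MeasurableSpace β] [DiscreteMeasurableSpace β]

lemma map_uniformOn_univ_of_bijective {e : Ω → α} (he : e.Bijective) :
    (uniformOn (Set.univ : Set Ω)).map e = uniformOn Set.univ := by
  refine Measure.ext_of_singleton fun a => ?_
  obtain ⟨x, rfl⟩ := he.2 a
  have : e ⁻¹' {e x} = {x} := by
    ext y
    simp [he.1.eq_iff]
  rw [Measure.map_apply .of_discrete .of_discrete, uniformOn_univ, uniformOn_univ, this,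
    Measure.count_singleton, Measure.count_singleton, Fintype.card_of_bijective he]

lemma uniformOn_univ_prod [Nonempty α] [Nonempty β] :
    (uniformOn (Set.univ : Set (α × β))) =
      (uniformOn (Set.univ : Set α)).prod (uniformOn (Set.univ : Set β)) := by
  have : IsProbabilityMeasure (uniformOn (Set.univ : Set β)) :=
    isProbabilityMeasure_uniformOn Set.finite_univ Set.univ_nonempty
  refine Measure.ext_of_singleton fun a => ?_
  obtain ⟨x, y⟩ := a
  rw [uniformOn_univ, Measure.count_singleton, ← Set.singleton_prod_singleton, Measure.prod_prod,
    uniformOn_univ, uniformOn_univ, Measure.count_singleton, Measure.count_singleton,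
    Fintype.card_prod, Nat.cast_mul, one_div, one_div, one_div,
    ENNReal.mul_inv (by simp) (by simp)]

/-- Under the uniform measure, the components of a bijection onto a product are independent. -/
lemma indepFun_of_bijective [Nonempty Ω] {X : Ω → α} {Y : Ω → β}
    (h : (fun ω => (X ω, Y ω)).Bijective) :
    IndepFun X Y (uniformOn (Set.univ : Set Ω)) := by
  have : Nonempty α := ⟨X (Classical.arbitrary Ω)⟩
  have : Nonempty β := ⟨Y (Classical.arbitrary Ω)⟩
  have : IsProbabilityMeasure (uniformOn (Set.univ : Set Ω)) :=
    isProbabilityMeasure_uniformOn Set.finite_univ Set.univ_nonempty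
  have : IsProbabilityMeasure (uniformOn (Set.univ : Set α)) :=
    isProbabilityMeasure_uniformOn Set.finite_univ Set.univ_nonempty
  have : IsProbabilityMeasure (uniformOn (Set.univ : Set β)) :=
    isProbabilityMeasure_uniformOn Set.finite_univ Set.univ_nonempty
  have hmap := (map_uniformOn_univ_of_bijective h).trans uniformOn_univ_prod
  have hX : (uniformOn (Set.univ : Set Ω)).map X = uniformOn Set.univ := by
    have := congrArg (Measure.map Prod.fst) hmap
    rw [Measure.map_map measurable_fst .of_discrete, Measure.map_fst_prod, measure_univ,
      one_smul] at this
    exact this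
  have hY : (uniformOn (Set.univ : Set Ω)).map Y = uniformOn Set.univ := by
    have := congrArg (Measure.map Prod.snd) hmap
    rw [Measure.map_map measurable_snd .of_discrete, Measure.map_snd_prod, measure_univ,
      one_smul] at this
    exact this
  rw [indepFun_iff_map_prod_eq_prod_map_map (Measurable.of_discrete).aemeasurable
    (Measurable.of_discrete).aemeasurable, hmap, hX, hY]

end Uniform

/-! ### Schemes built from permutations of the query set. -/

section Construction

variable {𝔽 : Type} [Fintype 𝔽] [Nonempty 𝔽] [MeasurableSpace 𝔽] [DiscreteMeasurableSpace 𝔽]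
  {N K L : ℕ} {Φ ρ : Type}
  [Fintype Φ] [Nonempty Φ] [MeasurableSpace Φ] [DiscreteMeasurableSpace Φ]
  [Fintype ρ] [Nonempty ρ] [MeasurableSpace ρ] [DiscreteMeasurableSpace ρ]
  {Ans : Fin N → Type} [∀ n, Fintype (Ans n)] [∀ n, MeasurableSpace (Ans n)]
  [∀ n, DiscreteMeasurableSpace (Ans n)]

/-- The scheme with uniform strategy randomness in `Φ` and common randomness in `ρ`, in which the
query to database `n` for message `k` is the image of the strategy randomness under the
permutation `σ n k`, and database `n` answers query `a` with `ans n a W R`. -/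
def permutationScheme (σ : Fin N → Fin K → Equiv.Perm Φ)
    (ans : ∀ n, Φ → (Fin K → Fin L → 𝔽) → ρ → Ans n) : RetrievalScheme 𝔽 N K L where
  Ω := (Fin K → Fin L → 𝔽) × Φ × ρ
  μ := uniformOn Set.univ
  prob := isProbabilityMeasure_uniformOn Set.finite_univ Set.univ_nonempty
  FAlph := Φ
  RAlph := ρ
  Query _ := Φ
  Answer := Ans
  W ω := ω.1
  F ω := ω.2.1
  R ω := ω.2.2
  Q n k ω := σ n k ω.2.1
  A n k ω := ans n (σ n k ω.2.1) ω.1 ω.2.2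
  measurable_W := measurable_fst
  measurable_F := .of_discrete
  measurable_R := .of_discrete
  measurable_Q _ _ := .of_discrete
  measurable_A _ _ := .of_discrete
  message_uniform := by
    have : IsProbabilityMeasure (uniformOn (Set.univ : Set (Φ × ρ))) :=
      isProbabilityMeasure_uniformOn Set.finite_univ Set.univ_nonempty
    rw [uniformOn_univ_prod]
    exact (Measure.map_fst_prod ..).trans (by rw [measure_univ, one_smul])
  message_indep := by
    have := isProbabilityMeasure_uniformOn (Set.finite_univ (α := (Fin K → Fin L → 𝔽) × Φ × ρ))
      Set.univ_nonempty
    exact (mutualInfo_eq_zero_iff .of_discrete .of_discrete).2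
      (indepFun_of_bijective Function.bijective_id)
  randomness_indep := by
    have := isProbabilityMeasure_uniformOn (Set.finite_univ (α := (Fin K → Fin L → 𝔽) × Φ × ρ))
      Set.univ_nonempty
    refine (mutualInfo_eq_zero_iff .of_discrete .of_discrete).2 ?_
    have h : IndepFun (fun ω : (Fin K → Fin L → 𝔽) × Φ × ρ => ω.2.1) (fun ω => (ω.1, ω.2.2))
        (uniformOn Set.univ) := by
      refine indepFun_of_bijective (Function.bijective_iff_has_inverse.2
        ⟨fun p => (p.2.1, p.1, p.2.2), fun _ => rfl, fun _ => rfl⟩)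
    exact h.comp measurable_id measurable_snd
  deterministic_query k := by
    have := isProbabilityMeasure_uniformOn (Set.finite_univ (α := (Fin K → Fin L → 𝔽) × Φ × ρ))
      Set.univ_nonempty
    exact condShannonEntropy_comp_eq_zero (.of_discrete) fun f n => σ n k f
  deterministic_answer n k := by
    have := isProbabilityMeasure_uniformOn (Set.finite_univ (α := (Fin K → Fin L → 𝔽) × Φ × ρ))
      Set.univ_nonempty
    exact condShannonEntropy_comp_eq_zero
      (Y := fun ω : (Fin K → Fin L → 𝔽) × Φ × ρ => (σ n k ω.2.1, ω.1, ω.2.2)) (.of_discrete)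
      fun p => ans n p.1 p.2.1 p.2.2

/-- User privacy holds because permuting uniform strategy randomness leaves it uniform. For database
privacy, `hdec` and `hinj` make `(W, F, R)` recoverable from the undesired messages, `F` and the
answers; by `hcard` this injection is a bijection onto the whole product, and the components of a
uniform point of a product are independent. -/
lemma permutationScheme_isSPIR (σ : Fin N → Fin K → Equiv.Perm Φ)
    (ans : ∀ n, Φ → (Fin K → Fin L → 𝔽) → ρ → Ans n)
    (dec : Fin K → Φ → (∀ n, Ans n) → Fin L → 𝔽)
    (hdec : ∀ k f w r, dec k f (fun n => ans n (σ n k f) w r) = w k)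
    (hinj : ∀ k f w r r', (∀ n, ans n (σ n k f) w r = ans n (σ n k f) w r') → r = r')
    (hcard : Fintype.card ρ * Fintype.card 𝔽 ^ L = ∏ n, Fintype.card (Ans n)) :
    (permutationScheme σ ans).IsSPIR where
  reliable k := by
    have h := condShannonEntropy_comp_eq_zero (μ := (permutationScheme σ ans).μ)
      (b := Fintype.card 𝔽) (Y := fun ω => ((permutationScheme σ ans).F ω,
        fun n => (permutationScheme σ ans).A n k ω))
      ((permutationScheme σ ans).measurable_F.prodMk (measurable_pi_iff.2 fun n =>
        (permutationScheme σ ans).measurable_A n k)) (fun p => dec k p.1 p.2)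
    rw [← h]
    congr 1
    funext ω
    exact (hdec k _ _ _).symm
  userPrivate n k k' := by
    have hT : ∀ k, (uniformOn Set.univ).map (fun ω : (Fin K → Fin L → 𝔽) × Φ × ρ =>
        (ω.1, σ n k ω.2.1, ω.2.2)) = uniformOn Set.univ := fun k =>
      map_uniformOn_univ_of_bijective (Function.bijective_iff_has_inverse.2
        ⟨fun p => (p.1, (σ n k).symm p.2.1, p.2.2), fun _ => by simp, fun _ => by simp⟩)
    have hmap : ∀ k, (uniformOn Set.univ).map (fun ω : (Fin K → Fin L → 𝔽) × Φ × ρ =>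
        (σ n k ω.2.1, ans n (σ n k ω.2.1) ω.1 ω.2.2, ω.1, ω.2.2)) =
        (uniformOn Set.univ).map (fun ω : (Fin K → Fin L → 𝔽) × Φ × ρ =>
          (ω.2.1, ans n ω.2.1 ω.1 ω.2.2, ω.1, ω.2.2)) := fun k => by
      conv_rhs => rw [← hT k]
      rw [Measure.map_map .of_discrete .of_discrete]
      rfl
    refine ⟨?_, ?_, (hmap k).trans (hmap k').symm⟩
    · exact (((permutationScheme σ ans).measurable_Q n k).prodMk
        (((permutationScheme σ ans).measurable_A n k).prodMk
        ((permutationScheme σ ans).measurable_W.prodMk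
          (permutationScheme σ ans).measurable_R))).aemeasurable
    · exact (((permutationScheme σ ans).measurable_Q n k').prodMk
        (((permutationScheme σ ans).measurable_A n k').prodMk
        ((permutationScheme σ ans).measurable_W.prodMk
          (permutationScheme σ ans).measurable_R))).aemeasurable
  databasePrivate k := by
    have := isProbabilityMeasure_uniformOn (Set.finite_univ (α := (Fin K → Fin L → 𝔽) × Φ × ρ))
      Set.univ_nonempty
    suffices h : mutualInfo (uniformOn Set.univ) (fun (ω : (Fin K → Fin L → 𝔽) × Φ × ρ)
        (j : {j : Fin K // j ≠ k}) => ω.1 j) (fun ω => (ω.2.1, fun n =>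
          ans n (σ n k ω.2.1) ω.1 ω.2.2)) = 0 from h
    refine (mutualInfo_eq_zero_iff .of_discrete .of_discrete).2 (indepFun_of_bijective ?_)
    refine (Fintype.bijective_iff_injective_and_card _).2 ⟨?_, ?_⟩
    · rintro ⟨w, f, r⟩ ⟨w', f', r'⟩ h
      simp only [Prod.mk.injEq] at h
      obtain ⟨h1, rfl, h2⟩ := h
      have hw : w = w' := by
        funext j
        by_cases hj : j = k
        · subst hj
          rw [← hdec j f w r, ← hdec j f w' r', h2]
        · exact congrFun h1 ⟨j, hj⟩
      subst hw
      rw [hinj k f w r r' fun n => congrFun h2 n]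
    · have hK : K = (K - 1) + 1 := by have := k.pos; omega
      simp only [Fintype.card_prod, Fintype.card_pi, Finset.prod_const, Finset.card_univ,
        Fintype.card_fin, ← hcard, ne_eq, Fintype.card_subtype_compl, Fintype.card_unique]
      conv_lhs => rw [hK, pow_succ]
      ring

end Construction

/-! ### The cube and Latin square schemes. -/

section Schemes

variable {𝔽 : Type} [Field 𝔽]

/-- The indicator of a bit in the field. -/
def bitValue (u : Bool) : 𝔽 := if u then 1 else 0

/-- The vertex of the cube with first coordinates `u` and last coordinate determined by the parity
`n`: even for the first database, odd for the second. -/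
def cubeVertex (n : Fin 2) (u : Bool × Bool) : Fin 3 → 𝔽 :=
  ![bitValue u.1, bitValue u.2, bitValue ((u.1 ^^ u.2) ^^ (n == 1))]

/-- The permutations moving an even vertex to the odd vertex adjacent to it in direction `k`. -/
def cubePerm (n : Fin 2) (k : Fin 3) : Equiv.Perm (Bool × Bool) :=
  if n = 0 then 1 else
    ![Equiv.prodCongr Equiv.boolNot (Equiv.refl _), Equiv.prodCongr (Equiv.refl _) Equiv.boolNot,
      1] k

def cubeAnswer (n : Fin 2) (u : Bool × Bool) (w : Fin 3 → Fin 1 → 𝔽) (r : 𝔽) : 𝔽 :=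
  ∑ j, cubeVertex n u j * w j 0 + r

/-- The two vertices differ only in coordinate `k`, by `±1`. The difference of answers cancels the
mask, and the prefactor restores the sign. -/
def cubeDecode (k : Fin 3) (u : Bool × Bool) (z : Fin 2 → 𝔽) (_ : Fin 1) : 𝔽 :=
  (cubeVertex 1 (cubePerm 1 k u) k - cubeVertex 0 u k) * (z 1 - z 0)

lemma cubeDecode_cubeAnswer (k : Fin 3) (u : Bool × Bool) (w : Fin 3 → Fin 1 → 𝔽) (r : 𝔽) :
    cubeDecode k u (fun n => cubeAnswer n (cubePerm n k u) w r) = w k := by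
  funext i
  obtain rfl := Subsingleton.elim i 0
  obtain ⟨a, b⟩ := u
  fin_cases k <;> cases a <;> cases b <;>
    simp [cubeDecode, cubeAnswer, cubePerm, cubeVertex, bitValue, Fin.sum_univ_three,
      Equiv.boolNot]

/-- The three random linear forms `R₀`, `R₁`, `W₀ + W₁ + W₂ - R₀ - R₁`. -/
def maskForm (i : Fin 3) (w : Fin 3 → Fin 1 → 𝔽) (r : Fin 2 → 𝔽) : 𝔽 :=
  ![r 0, r 1, w 0 0 + w 1 0 + w 2 0 - r 0 - r 1] i

/-- The query pair for message `k` is `(i, k - i)`, so the label of a pair is the sum of its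
entries. -/
def latinPerm (n : Fin 2) (k : Fin 3) : Equiv.Perm (Fin 3) :=
  if n = 0 then 1 else Equiv.subLeft k

def latinAnswer (n : Fin 2) (i : Fin 3) (w : Fin 3 → Fin 1 → 𝔽) (r : Fin 2 → 𝔽) :
    Fin (n + 1) → 𝔽 :=
  if n = 0 then fun _ => maskForm i w r else
    fun t => if t = 0 then w i 0 - r 0 else w (i + 1) 0 - r 1

/-- The masks `R₀` and `R₁` unlock the first and second symbol of the other answer. For `i = 2` the
second query is `k + 1`, and its two masked messages are subtracted from the masked total. -/
def latinDecode (_ : Fin 3) (i : Fin 3) (z : ∀ n : Fin 2, Fin (n + 1) → 𝔽) (_ : Fin 1) : 𝔽 :=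
  ![z 1 0 + z 0 0, z 1 1 + z 0 0, z 0 0 - z 1 0 - z 1 1] i

lemma latinDecode_latinAnswer (k i : Fin 3) (w : Fin 3 → Fin 1 → 𝔽) (r : Fin 2 → 𝔽) :
    latinDecode k i (fun n => latinAnswer n (latinPerm n k i) w r) = w k := by
  funext t
  obtain rfl := Subsingleton.elim t 0
  have e1 : (-2 : Fin 3) = 1 := rfl
  have e2 : (1 + 1 : Fin 3) = 2 := rfl
  fin_cases k <;> fin_cases i <;>
    simp [latinDecode, latinAnswer, latinPerm, maskForm, e1, e2] <;> ring

variable [Fintype 𝔽] [MeasurableSpace 𝔽] [DiscreteMeasurableSpace 𝔽]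

variable (𝔽) in
/-- The scheme with four queries and one answer symbol for each database. -/
def cubeScheme : RetrievalScheme 𝔽 2 3 1 := permutationScheme cubePerm cubeAnswer

variable (𝔽) in
/-- The scheme with three queries for each database, and one and two answer symbols. -/
def latinScheme : RetrievalScheme 𝔽 2 3 1 := permutationScheme latinPerm latinAnswer

lemma cubeScheme_isSPIR : (cubeScheme 𝔽).IsSPIR :=
  permutationScheme_isSPIR _ _ cubeDecode cubeDecode_cubeAnswer
    (fun k f w r r' h => by simpa [cubeAnswer] using h 0) (by simp [sq])

lemma latinScheme_isSPIR : (latinScheme 𝔽).IsSPIR :=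
  permutationScheme_isSPIR _ _ latinDecode latinDecode_latinAnswer
    (fun k f w r r' h => by
      have h0 : w (latinPerm 1 k f) 0 - r 0 = w (latinPerm 1 k f) 0 - r' 0 := congrFun (h 1) 0
      have h1 : w (latinPerm 1 k f + 1) 0 - r 1 = w (latinPerm 1 k f + 1) 0 - r' 1 :=
        congrFun (h 1) 1
      funext t
      fin_cases t
      · exact sub_right_injective h0
      · exact sub_right_injective h1)
    (by simp [Fin.prod_univ_two]; ring)

omit [MeasurableSpace 𝔽] [DiscreteMeasurableSpace 𝔽] in
lemma logb_card_card_self : Real.logb (Fintype.card 𝔽) (Fintype.card 𝔽) = 1 := by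
  have h : (1 : ℝ) < Fintype.card 𝔽 := by exact_mod_cast Fintype.one_lt_card
  exact Real.logb_self_eq_one h

lemma cubeScheme_uploadCost : (cubeScheme 𝔽).uploadCost = 4 := by
  have : Real.logb 2 4 = 2 := by
    rw [show (4 : ℝ) = 2 ^ 2 by norm_num, Real.logb_pow]
    simp
  have e : ∀ n, Fintype.card ((cubeScheme 𝔽).Query n) = 4 := fun _ => rfl
  simp only [RetrievalScheme.uploadCost, e, Fin.sum_univ_two, Nat.cast_ofNat, this]
  norm_num

lemma cubeScheme_downloadCost : (cubeScheme 𝔽).downloadCost = 2 := by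
  have e : ∀ n, Fintype.card ((cubeScheme 𝔽).Answer n) = Fintype.card 𝔽 := fun _ => rfl
  simp only [RetrievalScheme.downloadCost, e, Fin.sum_univ_two, logb_card_card_self]
  norm_num

lemma cubeScheme_commonRandomness : (cubeScheme 𝔽).commonRandomness = 1 := by
  have hne : (Real.log (Fintype.card 𝔽)) ≠ 0 :=
    (Real.log_natCast_pos Fintype.one_lt_card).ne'
  have : IsProbabilityMeasure (uniformOn (Set.univ : Set ((Fin 3 → Fin 1 → 𝔽) × (Bool × Bool)))) :=
    isProbabilityMeasure_uniformOn Set.finite_univ Set.univ_nonempty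
  have : IsProbabilityMeasure (uniformOn (Set.univ : Set ((Bool × Bool) × 𝔽))) :=
    isProbabilityMeasure_uniformOn Set.finite_univ Set.univ_nonempty
  have hR : (cubeScheme 𝔽).μ.map (cubeScheme 𝔽).R = uniformOn Set.univ := by
    have h : (uniformOn (Set.univ : Set ((Fin 3 → Fin 1 → 𝔽) × (Bool × Bool) × 𝔽))).map
        (fun ω => ((ω.1, ω.2.1), ω.2.2)) = uniformOn Set.univ :=
      map_uniformOn_univ_of_bijective (Function.bijective_iff_has_inverse.2
        ⟨fun p => (p.1.1, p.1.2, p.2), fun _ => rfl, fun _ => rfl⟩)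
    rw [uniformOn_univ_prod (α := (Fin 3 → Fin 1 → 𝔽) × Bool × Bool)] at h
    have h' := congrArg (Measure.map Prod.snd) h
    rw [Measure.map_map measurable_snd .of_discrete, Measure.map_snd_prod, measure_univ,
      one_smul] at h'
    exact h'
  have hx : ∀ x : 𝔽, (uniformOn (Set.univ : Set 𝔽) {x}).toReal = (Fintype.card 𝔽 : ℝ)⁻¹ := by
    intro x
    rw [uniformOn_univ, Measure.count_singleton]
    simp
  have hu : ∀ r, (cubeScheme 𝔽).μ.real ((cubeScheme 𝔽).R ⁻¹' {r}) = (Fintype.card 𝔽 : ℝ)⁻¹ :=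
    fun r => by
      rw [measureReal_def, ← Measure.map_apply (cubeScheme 𝔽).measurable_R
        (measurableSet_singleton r), hR]
      exact hx r
  have h := finEntropy_of_uniform (α := 𝔽) hu
  have h' := shannonEntropy_eq_finEntropy (μ := (cubeScheme 𝔽).μ) (b := Fintype.card 𝔽) (α := 𝔽)
    (cubeScheme 𝔽).R
  rw [h, div_self hne, ENNReal.ofReal_one] at h'
  exact h'

lemma latinScheme_uploadCost : (latinScheme 𝔽).uploadCost = 2 * Real.logb 2 3 := by
  have e : ∀ n, Fintype.card ((latinScheme 𝔽).Query n) = 3 := fun _ => rfl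
  simp only [RetrievalScheme.uploadCost, e, Fin.sum_univ_two, Nat.cast_ofNat, two_mul]

lemma latinScheme_downloadCost : (latinScheme 𝔽).downloadCost = 3 := by
  have e : ∀ n : Fin 2, Fintype.card ((latinScheme 𝔽).Answer n) =
      Fintype.card 𝔽 ^ ((n : ℕ) + 1) := fun n => by
    change Fintype.card (Fin ((n : ℕ) + 1) → 𝔽) = _
    simp
  simp only [RetrievalScheme.downloadCost, e, Nat.cast_pow, Real.logb_pow, logb_card_card_self,
    Fin.sum_univ_two]
  norm_num

end Schemes

/-! ### The main theorem. -/

theorem mainTheorem4 (𝔽 : Type) [Field 𝔽] [Fintype 𝔽] [MeasurableSpace 𝔽]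
    [DiscreteMeasurableSpace 𝔽] :
    -- the optimal total communication cost is 6
    IsLeast {c : ℝ | ∃ s : RetrievalScheme 𝔽 2 3 1,
      s.IsSPIR ∧ s.uploadCost + s.downloadCost = c} 6 ∧
    -- it is attained as 4 + 2, with common randomness 1 ...
    (∃ s : RetrievalScheme 𝔽 2 3 1, s.IsSPIR ∧
      s.uploadCost = 4 ∧ s.downloadCost = 2 ∧ s.commonRandomness = 1) ∧
    -- ... which is the least possible amount
    (∀ s : RetrievalScheme 𝔽 2 3 1, s.IsSPIR → 1 ≤ s.commonRandomness) ∧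
    -- the achievable region
    (∀ U D : ℝ, CostAchievable 𝔽 2 3 1 U D ↔
      (2 * Real.logb 2 3 ≤ U ∧ 3 ≤ D) ∨ (4 ≤ U ∧ 2 ≤ D)) ∧
    -- the converse even holds for the entropy of the answers in place of their size
    (∀ s : RetrievalScheme 𝔽 2 3 1, s.IsSPIR → ∀ k,
      (2 * Real.logb 2 3 ≤ s.uploadCost ∧ 3 ≤ s.answerEntropy k) ∨
        (4 ≤ s.uploadCost ∧ 2 ≤ s.answerEntropy k)) := by
  have region : ∀ s : RetrievalScheme 𝔽 2 3 1, s.IsSPIR →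
      (2 * Real.logb 2 3 ≤ s.uploadCost ∧ 3 ≤ s.downloadCost) ∨
        (4 ≤ s.uploadCost ∧ 2 ≤ s.downloadCost) := fun s hs =>
    (s.converse hs).2.imp
      (fun h => ⟨h.1, s.downloadCost_ge (k := 0) (by norm_num) (by simpa using h.2 0)⟩)
      (fun h => ⟨h.1, s.downloadCost_ge (k := 0) (by norm_num) (by simpa using h.2 0)⟩)
  refine ⟨⟨⟨cubeScheme 𝔽, cubeScheme_isSPIR, ?_⟩, ?_⟩, ⟨cubeScheme 𝔽, cubeScheme_isSPIR,
    cubeScheme_uploadCost, cubeScheme_downloadCost, cubeScheme_commonRandomness⟩,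
    fun s hs => (s.converse hs).1, fun U D => ⟨?_, ?_⟩, fun s hs k =>
    (s.converse hs).2.imp (fun h => ⟨h.1, h.2 k⟩) (fun h => ⟨h.1, h.2 k⟩)⟩
  · rw [cubeScheme_uploadCost, cubeScheme_downloadCost]
    norm_num
  · rintro c ⟨s, hs, rfl⟩
    -- As `3 ^ 2 ≥ 2 ^ 3`, the corner with three queries per database costs at least `3 + 3`, so it
    -- does not beat `4 + 2`.
    have h9 : 3 ≤ 2 * Real.logb 2 3 := by
      have h1 : (3 : ℝ) = Real.logb 2 (2 ^ 3) := by rw [Real.logb_pow]; simp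
      have h2 : 2 * Real.logb 2 3 = Real.logb 2 (3 ^ 2) := by rw [Real.logb_pow]; norm_num
      rw [h2]
      nth_rewrite 1 [h1]
      exact Real.logb_le_logb_of_le (by norm_num) (by norm_num) (by norm_num)
    rcases region s hs with h | h <;> linarith [h.1, h.2]
  · rintro ⟨s, hs, hU, hD⟩
    exact (region s hs).imp (fun h => ⟨h.1.trans hU, h.2.trans hD⟩)
      (fun h => ⟨h.1.trans hU, h.2.trans hD⟩)
  · rintro (⟨hU, hD⟩ | ⟨hU, hD⟩)
    · exact ⟨latinScheme 𝔽, latinScheme_isSPIR, latinScheme_uploadCost.trans_le hU,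
        latinScheme_downloadCost.trans_le hD⟩
    · exact ⟨cubeScheme 𝔽, cubeScheme_isSPIR, cubeScheme_uploadCost.trans_le hU,
        cubeScheme_downloadCost.trans_le hD⟩

end
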